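/- **Term graphs.** Let $B$ be a set. The signature $\mathsf{AT}(B)$ consists of the function symbols $\mathsf{AND}_n,\mathsf{OR}_n$ ($n\ge 1$) of arity $n$ and of the elements $b\in B$, of arity $0$. An *attack tree component* $T\colon i\to j$ over $B$ is a finite acyclic term graph over $\mathsf{AT}(B)$, up to isomorphism: a finite set of nodes $N^T$, a duplicate-free list of $i$ input nodes, a list of $j$ output nodes, and, for each non-input node $n$, a label in $\mathsf{AT}(B)$ and a list $\mathrm{ch}(n)$ of children in $N^T$ whose length is the arity of the label, such that the directed graph with edges $n\to m$ for $m\in \mathrm{ch}(n)$ is acyclic. Attack tree components form a channel category (a strict gs-monoidal category generated by one object) $\mathsf{TG}$: sequential composition glues the outputs of the first graph to the inputs of the second, parallel composition is disjoint union with concatenation of the input and output lists, and the identities, $\mathsf{swap}_{i,j}$, $\mathsf{copy}\colon 1\to 2$ and $\mathsf{del}\colon 1\to 0$ are the evident graphs without non-input nodes. For a function symbol $f$, $\langle f\rangle\colon \mathrm{arity}(f)\to 1$ denotes the graph with one non-input node, which is labelled $f$, is the output, and has the inputs in order as its children. **Stochastic matrices.** Let $R$ be a commutative semiring (with $0\cdot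 r=0$ for all $r$). In the channel category $\mathsf{BoolStoch}_R$ the channels $i\to j$ are the matrices $A\in R^{2^j\times 2^i}$, indexed by Boolean vectors, with $\sum_{y\in 2^j}A_{yx}=1$ for all $x\in 2^i$, where $2=\{0,1\}$. Sequential composition is matrix multiplication, parallel composition is the Kronecker product, identities are identity matrices, and $\mathsf{swap}_{i,j}$, $\mathsf{copy}$, $\mathsf{del}$ are the $0/1$-matrices of the functions that interchange the first $i$ with the last $j$ coordinates, duplicate a bit, and discard a bit. Let $\alpha_0,\alpha_1\colon B\to R$ satisfy $\alpha_0(b)+\alpha_1(b)=1$ for all $b\in B$. The stochastic matrix interpretation $\mathcal I=\mathcal I^{\alpha}_{\mathsf{stoch}}$ sends $\mathsf{AND}_n$ and $\mathsf{OR}_n$ to the $0/1$-matrices of the Boolean functions $\bigwedge$ and $\bigvee$ on $2^n$, and $b\in B$ to the column $(\alpha_0(b),\alpha_1(b))^{\top}$. **Attacks.** For $T\colon i\to j$, let $\mathsf{BAS}(T)$ be the set of nodes $v$ with a label $\ell(v)\in B$; an *attack* is a map $a\colon\mathsf{BAS}(T)\to\{0,1\}$, and $\mathsf{Attacks}(T)$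 is the set of attacks. For an attack $a$ and $x\in 2^i$ define $S_T(a,x;n)\in\{0,1\}$ recursively: it is $x_k$ if $n$ is the $k$-th input, $a(n)$ if $n\in\mathsf{BAS}(T)$, and the conjunction (disjunction) of the values of the children of $n$ if $n$ is labelled by an AND (OR) symbol. Let $S_T(a,x)\in 2^j$ be the vector of the values of the output nodes. **Theorem.** There is exactly one functor of channel categories $\mathsf{TG}\to\mathsf{BoolStoch}_R$ (a family of maps on channels that preserves sequential and parallel composition, identities, $\mathsf{swap}_{i,j}$, $\mathsf{copy}$ and $\mathsf{del}$) that sends $\langle f\rangle$ to $\mathcal I(f)$ for every $f\in \mathsf{AT}(B)$. Writing $[\![T]\!]_{\mathcal I}$ for its value at $T$, for all $i,j\ge 0$, every attack tree component $T\colon i\to j$ over $B$, and all $y\in 2^j$, $x\in 2^i$, $$\bigl([\![T]\!]_{\mathcal I}\bigr)_{yx}=\sum_{\substack{a\in\mathsf{Attacks}(T)\\ S_T(a,x)=y}}\Bigl(\prod_{v\in\mathsf{BAS}(T),\,a(v)=1}\alpha_1(\ell(v))\Bigr)\cdot\Bigl(\prod_{v\in\mathsf{BAS}(T),\,a(v)=0}\alpha_0(\ell(v))\Bigr).$$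 -/

import Mathlib

open scoped Kronecker

universe u v w

namespace AttackTree

/-! ### Channel categories -/

/-- Transport of a channel along equalities between numbers of inputs and of outputs. -/
def castHom {Hom : ℕ → ℕ → Type w} {i i' j j' : ℕ} (hi : i = i') (hj : j = j')
    (f : Hom i j) : Hom i' j' :=
  hj ▸ hi ▸ f

/-- Channel categories, that is, strict gs-monoidal categories generated by a single object.
`comp f g` is `g ∘ f` (first `f`, then `g`), and `par f g` is `f ⊗ g` (the wires of `f` come
first). The gate `swap i j` moves the first `i` wires behind the last `j` wires. -/
structure ChannelCategory where
  Hom : ℕ → ℕ → Type w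
  comp : ∀ {i j k : ℕ}, Hom i j → Hom j k → Hom i k
  par : ∀ {i j k l : ℕ}, Hom i j → Hom k l → Hom (i + k) (j + l)
  id : ∀ i : ℕ, Hom i i
  swap : ∀ i j : ℕ, Hom (i + j) (j + i)
  copy : Hom 1 2
  del : Hom 1 0
  comp_assoc : ∀ {i j k l : ℕ} (f : Hom i j) (g : Hom j k) (h : Hom k l),
    comp (comp f g) h = comp f (comp g h)
  id_comp : ∀ {i j : ℕ} (f : Hom i j), comp (id i) f = f
  comp_id : ∀ {i j : ℕ} (f : Hom i j), comp f (id j) = f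
  par_assoc : ∀ {i₁ j₁ i₂ j₂ i₃ j₃ : ℕ} (f : Hom i₁ j₁) (g : Hom i₂ j₂) (h : Hom i₃ j₃),
    castHom (Nat.add_assoc i₁ i₂ i₃) (Nat.add_assoc j₁ j₂ j₃) (par (par f g) h)
      = par f (par g h)
  par_id_zero : ∀ {i j : ℕ} (f : Hom i j),
    castHom (Nat.add_zero i) (Nat.add_zero j) (par f (id 0)) = f
  id_zero_par : ∀ {i j : ℕ} (f : Hom i j),
    castHom (Nat.zero_add i) (Nat.zero_add j) (par (id 0) f) = f
  id_par_id : ∀ i j : ℕ, par (id i) (id j) = id (i + j)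
  interchange : ∀ {i j k l m n : ℕ} (f₁ : Hom i j) (f₂ : Hom k l) (g₁ : Hom j m) (g₂ : Hom l n),
    comp (par f₁ f₂) (par g₁ g₂) = par (comp f₁ g₁) (comp f₂ g₂)
  swap_natural : ∀ {i j k l : ℕ} (f : Hom i j) (g : Hom k l),
    comp (par f g) (swap j l) = comp (swap i k) (par g f)
  swap_swap : ∀ i j : ℕ, comp (swap i j) (swap j i) = id (i + j)
  swap_add : ∀ i j k : ℕ,
    castHom (Nat.add_assoc i j k) (Nat.add_assoc j k i).symm
      (comp (par (swap i j) (id k))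
        (castHom (Nat.add_assoc j i k).symm rfl (par (id j) (swap i k))))
      = swap i (j + k)
  copy_assoc : comp copy (par copy (id 1)) = comp copy (par (id 1) copy)
  copy_del_left : comp copy (par del (id 1)) = id 1
  copy_del_right : comp copy (par (id 1) del) = id 1
  copy_swap : comp copy (swap 1 1) = copy

/-- Functors of channel categories. -/
@[ext] structure ChannelFunctor (C : ChannelCategory.{v}) (D : ChannelCategory.{w}) where
  map : ∀ {i j : ℕ}, C.Hom i j → D.Hom i j
  map_comp : ∀ {i j k : ℕ} (f : C.Hom i j) (g : C.Hom j k),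
    map (C.comp f g) = D.comp (map f) (map g)
  map_par : ∀ {i j k l : ℕ} (f : C.Hom i j) (g : C.Hom k l),
    map (C.par f g) = D.par (map f) (map g)
  map_id : ∀ i : ℕ, map (C.id i) = D.id i
  map_swap : ∀ i j : ℕ, map (C.swap i j) = D.swap i j
  map_copy : map C.copy = D.copy
  map_del : map C.del = D.del

/-! ### Rearrangements of wires -/

/-- Interchange of the first `i` with the last `j` wires: the outputs are the last `j` inputs,
followed by the first `i` inputs. -/
def swapIndex (i j : ℕ) : Fin (j + i) → Fin (i + j) :=
  Fin.append (Fin.natAdd i) (Fin.castAdd j)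

/-- Two rearrangements of wires side by side. -/
def parIndex {i j k l : ℕ} (f : Fin j → Fin i) (g : Fin l → Fin k) : Fin (j + l) → Fin (i + k) :=
  Fin.append (fun a => Fin.castAdd k (f a)) (fun a => Fin.natAdd i (g a))

theorem val_swapIndex (i j : ℕ) (a : Fin (j + i)) :
    (swapIndex i j a : ℕ) = if (a : ℕ) < j then i + a else a - j := by
  refine Fin.addCases (fun a => ?_) (fun a => ?_) a <;> simp [swapIndex]

theorem val_parIndex {i j k l : ℕ} (f : Fin j → Fin i) (g : Fin l → Fin k) (a : Fin (j + l)) :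
    (parIndex f g a : ℕ) = if h : (a : ℕ) < j then (f ⟨a, h⟩ : ℕ) else i + g ⟨a - j, by omega⟩ := by
  refine Fin.addCases (fun a => ?_) (fun a => ?_) a <;> simp [parIndex]

theorem parIndex_id (i j : ℕ) : parIndex (fun a : Fin i => a) (fun a : Fin j => a) = fun a => a := by
  funext a
  ext
  rw [val_parIndex]
  split_ifs <;> simp; omega

theorem swapIndex_swapIndex (i j : ℕ) (a : Fin (i + j)) : swapIndex i j (swapIndex j i a) = a := by
  ext
  rw [val_swapIndex, val_swapIndex]
  split_ifs <;> omega

theorem swapIndex_add (i j k : ℕ) (a : Fin (j + k + i)) :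
    Fin.cast (Nat.add_assoc i j k) (parIndex (swapIndex i j) (fun a : Fin k => a)
      (Fin.cast (Nat.add_assoc j i k).symm (parIndex (fun a : Fin j => a) (swapIndex i k)
        (Fin.cast (Nat.add_assoc j k i) a)))) = swapIndex i (j + k) a := by
  ext
  simp only [val_swapIndex, val_parIndex, Fin.val_cast]
  split_ifs <;> simp_all <;> omega

/-! ### Term graphs -/

/-- A single-sorted algebraic signature. -/
structure Signature where
  Symbol : Type u
  arity : Symbol → ℕ

/-- The edge relation of a graph whose nodes are `i` inputs (without children) and internal nodes
`V` with the lists of children `ch`: there is an edge from each internal node to its children. -/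
def Edge {i : ℕ} {V : Type} (ch : V → List (Fin i ⊕ V)) (n m : Fin i ⊕ V) : Prop :=
  ∃ v : V, n = Sum.inr v ∧ m ∈ ch v

/-- A term graph over `S` with `i` inputs and `j` outputs. As the list of input nodes has no
duplicates and term graphs are taken up to isomorphism, the `k`-th input node is named by its
position `k : Fin i`; the finite set of nodes is thus `Fin i ⊕ V` with `V` the non-input nodes. -/
structure TermGraph (S : Signature.{u}) (i j : ℕ) where
  V : Type
  finite : Finite V
  label : V → S.Symbol
  ch : V → List (Fin i ⊕ V)
  out : Fin j → Fin i ⊕ V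
  length_ch : ∀ v, (ch v).length = S.arity (label v)
  acyclic : ∀ n, ¬ Relation.TransGen (Edge ch) n n

namespace TermGraph

variable {S : Signature.{u}} {i j k l : ℕ}

/-- The set of all nodes, input nodes included. -/
abbrev Node (T : TermGraph S i j) : Type := Fin i ⊕ T.V

instance (T : TermGraph S i j) : Finite T.V := T.finite

/-- For finite graphs, acyclicity is well-foundedness of the relation "is a child of". -/
theorem wf_iff_acyclic {V : Type} [Finite V] (ch : V → List (Fin i ⊕ V)) :
    WellFounded (fun m n => Edge ch n m) ↔ ∀ n, ¬ Relation.TransGen (Edge ch) n n := by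
  constructor
  · intro h n hn
    have h2 := h.transGen
    have h3 : Relation.TransGen (fun m n => Edge ch n m) n n :=
      Relation.transGen_swap.1 hn
    exact h2.irrefl.irrefl n h3
  · intro h
    let r : (Fin i ⊕ V) → (Fin i ⊕ V) → Prop := Relation.TransGen (fun m n => Edge ch n m)
    have : Std.Irrefl r := ⟨fun n hn => h n (Relation.transGen_swap.1 hn)⟩
    have : IsTrans (Fin i ⊕ V) r := ⟨fun a b c => Relation.TransGen.trans⟩
    have hr : WellFounded r := Finite.wellFounded_of_trans_of_irrefl r
    exact Subrelation.wf (r := r) (fun {a b} hab => Relation.TransGen.single hab) hr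

theorem wf (T : TermGraph S i j) : WellFounded (fun m n => Edge T.ch n m) :=
  (wf_iff_acyclic T.ch).2 T.acyclic

/-- Two disjoint graphs of non-input nodes, where the second may point to the first. -/
theorem acyclic_sum {V W : Type} [Finite V] [Finite W] (chV : V → List (Fin i ⊕ V))
    (chW : W → List (Fin k ⊕ W)) (hV : ∀ n, ¬ Relation.TransGen (Edge chV) n n)
    (hW : ∀ n, ¬ Relation.TransGen (Edge chW) n n)
    (ch : V ⊕ W → List (Fin l ⊕ (V ⊕ W)))
    (h₁ : ∀ v v', Sum.inr (Sum.inl v') ∈ ch (Sum.inl v) → Sum.inr v' ∈ chV v)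
    (h₂ : ∀ v w, Sum.inr (Sum.inr w) ∉ ch (Sum.inl v))
    (h₃ : ∀ w w', Sum.inr (Sum.inr w') ∈ ch (Sum.inr w) → Sum.inr w' ∈ chW w) :
    ∀ n, ¬ Relation.TransGen (Edge ch) n n := by
  rw [← wf_iff_acyclic]
  have wV := InvImage.wf (Sum.inr : V → _) ((wf_iff_acyclic chV).2 hV)
  have wW := InvImage.wf (Sum.inr : W → _) ((wf_iff_acyclic chW).2 hW)
  have key : ∀ x : V ⊕ W, Acc (fun m n => Edge ch n m) (Sum.inr x) := by
    intro x
    induction x using (Sum.lex_wf wV wW).induction with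
    | _ x ih =>
      refine ⟨_, fun m hm => ?_⟩
      obtain ⟨y, hy, hm⟩ := hm
      cases hy
      rcases m with m | m
      · exact ⟨_, fun m' hm' => by obtain ⟨y, hy, _⟩ := hm'; cases hy⟩
      · apply ih
        rcases x with x | x <;> rcases m with m | m
        · exact Sum.Lex.inl ⟨x, rfl, h₁ _ _ hm⟩
        · exact absurd hm (h₂ _ _)
        · exact Sum.Lex.sep _ _
        · exact Sum.Lex.inr ⟨x, rfl, h₃ _ _ hm⟩
  refine ⟨fun n => ?_⟩
  rcases n with n | n
  · exact ⟨_, fun m' hm' => by obtain ⟨y, hy, _⟩ := hm'; cases hy⟩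
  · exact key n

/-- Isomorphism of term graphs: a bijection of nodes that preserves the inputs and the outputs with
their order, the labels, and the lists of children. -/
def Iso (T T' : TermGraph S i j) : Prop :=
  ∃ e : T.V ≃ T'.V, (∀ v, T'.label (e v) = T.label v) ∧
    (∀ v, T'.ch (e v) = (T.ch v).map (Sum.map id e)) ∧
    ∀ o, T'.out o = Sum.map id e (T.out o)

instance setoid (S : Signature.{u}) (i j : ℕ) : Setoid (TermGraph S i j) where
  r := Iso
  iseqv :=
    { refl := fun T => ⟨Equiv.refl _, by simp, by simp, by simp⟩
      symm := by
        rintro T T' ⟨e, h₁, h₂, h₃⟩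
        refine ⟨e.symm, fun v => ?_, fun v => ?_, fun o => ?_⟩
        · simpa using (h₁ (e.symm v)).symm
        · have := h₂ (e.symm v)
          simp only [Equiv.apply_symm_apply] at this
          simp [this]
        · simp [h₃]
      trans := by
        rintro T T' T'' ⟨e, h₁, h₂, h₃⟩ ⟨f, g₁, g₂, g₃⟩
        refine ⟨e.trans f, fun v => ?_, fun v => ?_, fun o => ?_⟩
        · simp [h₁, g₁]
        · simp [h₂, g₂]
        · simp [h₃, g₃] }

/-- The node map `N^T → N^(U ∘ T)` into a sequential composite. -/
def seqInl (T : TermGraph S i j) (U : TermGraph S j k) : T.Node → Fin i ⊕ (T.V ⊕ U.V) :=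
  Sum.map id Sum.inl

/-- The node map `N^U → N^(U ∘ T)` into a sequential composite: the `l`-th input node of `U` is
identified with the `l`-th output node of `T`. -/
def seqInr (T : TermGraph S i j) (U : TermGraph S j k) : U.Node → Fin i ⊕ (T.V ⊕ U.V) :=
  Sum.elim (fun o => seqInl T U (T.out o)) (fun v => Sum.inr (Sum.inr v))

/-- The sequential composition `U ∘ T`. Each class of nodes of the disjoint union, after each input
of `U` is identified with the corresponding output of `T`, contains exactly one node that is a node
of `T` or a non-input node of `U`; these nodes represent the classes. -/
def seq (T : TermGraph S i j) (U : TermGraph S j k) : TermGraph S i k where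
  V := T.V ⊕ U.V
  finite := inferInstance
  label := Sum.elim T.label U.label
  ch := Sum.elim (fun v => (T.ch v).map (seqInl T U)) (fun v => (U.ch v).map (seqInr T U))
  out := fun o => seqInr T U (U.out o)
  length_ch := by
    rintro (v | v)
    · simpa using T.length_ch v
    · simpa using U.length_ch v
  acyclic := by
    apply acyclic_sum T.ch U.ch T.acyclic U.acyclic
    · simp [seqInl]
    · simp [seqInl]
    · intro w w' h
      simp only [Sum.elim_inr, List.mem_map] at h
      obtain ⟨n, hn, h⟩ := h
      rcases n with n | n
      · simp only [seqInr, seqInl, Sum.elim_inl] at h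
        generalize T.out n = m at h
        rcases m with m | m <;> simp at h
      · simp only [seqInr, Sum.elim_inr, Sum.inr.injEq] at h
        exact h ▸ hn

/-- The gluing relation on the disjoint union of the nodes. -/
inductive Glue (T : TermGraph S i j) (U : TermGraph S j k) : T.Node ⊕ U.Node → T.Node ⊕ U.Node → Prop
  | glue (o : Fin j) : Glue T U (Sum.inl (T.out o)) (Sum.inr (Sum.inl o))

/-- The nodes of the sequential composite are the quotient of the disjoint union of the nodes by
the equivalence relation generated by the gluing, with the expected projection. -/
theorem seq_node_eq_iff (T : TermGraph S i j) (U : TermGraph S j k) :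
    Function.Surjective (Sum.elim (seqInl T U) (seqInr T U)) ∧
    ∀ n m, Sum.elim (seqInl T U) (seqInr T U) n = Sum.elim (seqInl T U) (seqInr T U) m ↔
      Relation.EqvGen (Glue T U) n m := by
  have hr : ∀ n, ∃ m : T.Node ⊕ U.V, Relation.EqvGen (Glue T U) n (Sum.map id Sum.inr m) := by
    rintro (n | n | n)
    · exact ⟨Sum.inl n, .refl _⟩
    · exact ⟨Sum.inl (T.out n), .symm _ _ (.rel _ _ (.glue n))⟩
    · exact ⟨Sum.inr n, .refl _⟩
  have hf : ∀ n m, Relation.EqvGen (Glue T U) n m →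
      Sum.elim (seqInl T U) (seqInr T U) n = Sum.elim (seqInl T U) (seqInr T U) m := by
    intro n m h
    induction h with
    | rel _ _ h => cases h; rfl
    | refl _ => rfl
    | symm _ _ _ h => exact h.symm
    | trans _ _ _ _ _ h₁ h₂ => exact h₁.trans h₂
  refine ⟨?_, fun n m => ⟨fun h => ?_, hf n m⟩⟩
  · rintro (n | n | n)
    · exact ⟨Sum.inl (Sum.inl n), rfl⟩
    · exact ⟨Sum.inl (Sum.inr n), rfl⟩
    · exact ⟨Sum.inr (Sum.inr n), rfl⟩
  · obtain ⟨n', hn⟩ := hr n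
    obtain ⟨m', hm⟩ := hr m
    rw [hf _ _ hn, hf _ _ hm] at h
    have : n' = m' := by
      rcases n' with (n' | n') | n' <;> rcases m' with (m' | m') | m' <;>
        simp_all [seqInl, seqInr]
    subst this
    exact .trans _ _ _ hn (.symm _ _ hm)

/-- The node map `N^T → N^(T ⊗ U)` into a parallel composite. -/
def parInl (T : TermGraph S i j) (U : TermGraph S k l) : T.Node → Fin (i + k) ⊕ (T.V ⊕ U.V) :=
  Sum.map (Fin.castAdd k) Sum.inl

/-- The node map `N^U → N^(T ⊗ U)` into a parallel composite. -/
def parInr (T : TermGraph S i j) (U : TermGraph S k l) : U.Node → Fin (i + k) ⊕ (T.V ⊕ U.V) :=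
  Sum.map (Fin.natAdd i) Sum.inr

/-- The parallel composition `T ⊗ U`: the disjoint union, with concatenated lists of inputs and of
outputs. -/
def tensor (T : TermGraph S i j) (U : TermGraph S k l) : TermGraph S (i + k) (j + l) where
  V := T.V ⊕ U.V
  finite := inferInstance
  label := Sum.elim T.label U.label
  ch := Sum.elim (fun v => (T.ch v).map (parInl T U)) (fun v => (U.ch v).map (parInr T U))
  out := Fin.append (fun o => parInl T U (T.out o)) (fun o => parInr T U (U.out o))
  length_ch := by
    rintro (v | v)
    · simpa using T.length_ch v
    · simpa using U.length_ch v
  acyclic := by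
    apply acyclic_sum T.ch U.ch T.acyclic U.acyclic
    · simp [parInl]
    · simp [parInl]
    · simp [parInr]

/-- The term graph without non-input nodes whose `o`-th output is the `f o`-th input. -/
def wiring (S : Signature.{u}) {i j : ℕ} (f : Fin j → Fin i) : TermGraph S i j where
  V := Empty
  finite := inferInstance
  label := Empty.elim
  ch := fun v => v.elim
  out := fun o => Sum.inl (f o)
  length_ch := fun v => v.elim
  acyclic := by
    rw [← wf_iff_acyclic]
    exact ⟨fun n => ⟨_, fun m ⟨v, _⟩ => v.elim⟩⟩

/-- The term graph `⟨f⟩` of a function symbol: one node labelled `f`, which is the output and whose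
children are the inputs in order. -/
def ofSymbol {S : Signature.{u}} (f : S.Symbol) : TermGraph S (S.arity f) 1 where
  V := Unit
  finite := inferInstance
  label := fun _ => f
  ch := fun _ => List.ofFn Sum.inl
  out := fun _ => Sum.inr ()
  length_ch := by simp
  acyclic := by
    rw [← wf_iff_acyclic]
    have h : ∀ n : Fin (S.arity f),
        Acc (fun m n => Edge (V := Unit) (fun _ => List.ofFn Sum.inl) n m) (Sum.inl n) :=
      fun n => ⟨_, fun m ⟨v, hv, _⟩ => by cases hv⟩
    refine ⟨fun n => ⟨_, fun m ⟨v, hv, hm⟩ => ?_⟩⟩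
    simp only [List.mem_ofFn] at hm
    obtain ⟨y, rfl⟩ := hm
    exact h y

theorem castHom_mk {i' j' : ℕ} (hi : i = i') (hj : j = j') (T : TermGraph S i j)
    (T' : TermGraph S i' j') (e : T.V ≃ T'.V) (h₁ : ∀ v, T'.label (e v) = T.label v)
    (h₂ : ∀ v, T'.ch (e v) = (T.ch v).map (Sum.map (Fin.cast hi) e))
    (h₃ : ∀ o, T'.out (Fin.cast hj o) = Sum.map (Fin.cast hi) e (T.out o)) :
    castHom (Hom := fun i j => Quotient (setoid S i j)) hi hj (Quotient.mk _ T)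
      = Quotient.mk _ T' := by
  subst hi hj
  exact Quotient.sound ⟨e, h₁, h₂, h₃⟩

section lists

variable {α β γ δ ε : Type}

theorem map01 {a : α → β} {b : β → α} (h : ∀ n, b (a n) = n) (L : List α) :
    L = (L.map a).map b := by
  rw [List.map_map, show b ∘ a = id from funext h, List.map_id]

theorem map12 {d : α → δ} {a : α → β} {a' : β → γ} {b : γ → δ} (h : ∀ n, b (a' (a n)) = d n)
    (L : List α) : L.map d = ((L.map a).map a').map b := by
  rw [List.map_map, List.map_map, show (b ∘ a') ∘ a = d from funext h]

theorem map21 {c : α → ε} {d : ε → δ} {a : α → β} {b : β → δ} (h : ∀ n, b (a n) = d (c n))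
    (L : List α) : (L.map c).map d = (L.map a).map b := by
  rw [List.map_map, List.map_map, show b ∘ a = d ∘ c from funext h]

theorem map22 {c : α → ε} {d : ε → δ} {a : α → β} {a' : β → γ} {b : γ → δ}
    (h : ∀ n, b (a' (a n)) = d (c n)) (L : List α) :
    (L.map c).map d = ((L.map a).map a').map b := by
  rw [List.map_map, List.map_map, List.map_map, show (b ∘ a') ∘ a = d ∘ c from funext h]

end lists

theorem seq_congr {T T' : TermGraph S i j} {U U' : TermGraph S j k} (hT : Iso T T')
    (hU : Iso U U') : Iso (seq T U) (seq T' U') := by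
  obtain ⟨e, h₁, h₂, h₃⟩ := hT
  obtain ⟨f, g₁, g₂, g₃⟩ := hU
  have hl : ∀ n, Sum.map id (e.sumCongr f) (seqInl T U n) = seqInl T' U' (Sum.map id e n) := by
    rintro (n | n) <;> rfl
  have hr : ∀ n, Sum.map id (e.sumCongr f) (seqInr T U n) = seqInr T' U' (Sum.map id f n) := by
    rintro (n | n)
    · exact (hl (T.out n)).trans (congrArg (seqInl T' U') (h₃ n).symm)
    · rfl
  refine ⟨e.sumCongr f, ?_, ?_, fun o => ?_⟩
  · rintro (v | v)
    · exact h₁ v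
    · exact g₁ v
  · rintro (v | v)
    · exact (congrArg (List.map (seqInl T' U')) (h₂ v)).trans (map21 hl (T.ch v))
    · exact (congrArg (List.map (seqInr T' U')) (g₂ v)).trans (map21 hr (U.ch v))
  · exact (congrArg (seqInr T' U') (g₃ o)).trans (hr (U.out o)).symm

theorem tensor_out_left (T : TermGraph S i j) (U : TermGraph S k l) (o : Fin j) :
    (tensor T U).out (Fin.castAdd l o) = parInl T U (T.out o) :=
  Fin.append_left (fun o => parInl T U (T.out o)) (fun o => parInr T U (U.out o)) o

theorem tensor_out_right (T : TermGraph S i j) (U : TermGraph S k l) (o : Fin l) :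
    (tensor T U).out (Fin.natAdd j o) = parInr T U (U.out o) :=
  Fin.append_right (fun o => parInl T U (T.out o)) (fun o => parInr T U (U.out o)) o

theorem tensor_congr {T T' : TermGraph S i j} {U U' : TermGraph S k l} (hT : Iso T T')
    (hU : Iso U U') : Iso (tensor T U) (tensor T' U') := by
  obtain ⟨e, h₁, h₂, h₃⟩ := hT
  obtain ⟨f, g₁, g₂, g₃⟩ := hU
  have hl : ∀ n, Sum.map id (e.sumCongr f) (parInl T U n) = parInl T' U' (Sum.map id e n) := by
    rintro (n | n) <;> rfl
  have hr : ∀ n, Sum.map id (e.sumCongr f) (parInr T U n) = parInr T' U' (Sum.map id f n) := by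
    rintro (n | n) <;> rfl
  refine ⟨e.sumCongr f, ?_, ?_, fun o => ?_⟩
  · rintro (v | v)
    · exact h₁ v
    · exact g₁ v
  · rintro (v | v)
    · exact (congrArg (List.map (parInl T' U')) (h₂ v)).trans (map21 hl (T.ch v))
    · exact (congrArg (List.map (parInr T' U')) (g₂ v)).trans (map21 hr (U.ch v))
  · refine Fin.addCases (fun o => ?_) (fun o => ?_) o
    · rw [tensor_out_left, tensor_out_left, h₃]
      exact (hl (T.out o)).symm
    · rw [tensor_out_right, tensor_out_right, g₃]
      exact (hr (U.out o)).symm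

theorem seq_assoc (T : TermGraph S i j) (U : TermGraph S j k) (W : TermGraph S k l) :
    Iso ((T.seq U).seq W) (T.seq (U.seq W)) := by
  have hl : ∀ n, Sum.map id (Equiv.sumAssoc T.V U.V W.V) ((T.seq U).seqInl W (T.seqInl U n))
      = T.seqInl (U.seq W) n := by
    rintro (n | n) <;> rfl
  have hm : ∀ n, Sum.map id (Equiv.sumAssoc T.V U.V W.V) ((T.seq U).seqInl W (T.seqInr U n))
      = T.seqInr (U.seq W) (U.seqInl W n) := by
    rintro (n | n)
    · exact hl (T.out n)
    · rfl
  have hr : ∀ n, Sum.map id (Equiv.sumAssoc T.V U.V W.V) ((T.seq U).seqInr W n)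
      = T.seqInr (U.seq W) (U.seqInr W n) := by
    rintro (n | n)
    · exact hm (U.out n)
    · rfl
  refine ⟨Equiv.sumAssoc _ _ _, ?_, ?_, fun o => (hr (W.out o)).symm⟩
  · rintro ((v | v) | v) <;> rfl
  · rintro ((v | v) | v)
    · exact map12 hl (T.ch v)
    · exact map22 hm (U.ch v)
    · exact map21 hr (W.ch v)

theorem wiring_seq (T : TermGraph S i j) : Iso ((wiring S fun o : Fin i => o).seq T) T := by
  have hr : ∀ n, Sum.map id (Equiv.emptySum Empty T.V) ((wiring S fun o : Fin i => o).seqInr T n)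
      = n := by
    rintro (n | n) <;> rfl
  refine ⟨Equiv.emptySum Empty T.V, ?_, ?_, fun o => (hr (T.out o)).symm⟩
  · rintro (v | v)
    · exact v.elim
    · rfl
  · rintro (v | v)
    · exact v.elim
    · exact map01 hr (T.ch v)

theorem seq_wiring (T : TermGraph S i j) : Iso (T.seq (wiring S fun o : Fin j => o)) T := by
  have hl : ∀ n, Sum.map id (Equiv.sumEmpty T.V Empty) (T.seqInl (wiring S fun o : Fin j => o) n)
      = n := by
    rintro (n | n) <;> rfl
  refine ⟨Equiv.sumEmpty T.V Empty, ?_, ?_, fun o => (hl (T.out o)).symm⟩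
  · rintro (v | v)
    · rfl
    · exact v.elim
  · rintro (v | v)
    · exact map01 hl (T.ch v)
    · exact v.elim

theorem wiring_seq_wiring (f : Fin j → Fin i) (g : Fin k → Fin j) :
    Iso ((wiring S f).seq (wiring S g)) (wiring S fun o => f (g o)) :=
  ⟨Equiv.sumEmpty Empty Empty, fun v => (v.elim Empty.elim Empty.elim : Empty).elim,
    fun v => (v.elim Empty.elim Empty.elim : Empty).elim, fun _ => rfl⟩

theorem wiring_tensor_wiring (f : Fin j → Fin i) (g : Fin l → Fin k) :
    Iso ((wiring S f).tensor (wiring S g)) (wiring S (parIndex f g)) := by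
  refine ⟨Equiv.sumEmpty Empty Empty, fun v => (v.elim Empty.elim Empty.elim : Empty).elim,
    fun v => (v.elim Empty.elim Empty.elim : Empty).elim, fun o => ?_⟩
  refine Fin.addCases (fun o => ?_) (fun o => ?_) o
  · rw [tensor_out_left]
    exact congrArg Sum.inl (Fin.append_left _ _ o)
  · rw [tensor_out_right]
    exact congrArg Sum.inl (Fin.append_right _ _ o)

theorem castHom_wiring {i' j' : ℕ} (hi : i = i') (hj : j = j') (f : Fin j → Fin i) :
    castHom (Hom := fun i j => Quotient (setoid S i j)) hi hj (Quotient.mk _ (wiring S f))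
      = Quotient.mk _ (wiring S fun o => Fin.cast hi (f (Fin.cast hj.symm o))) :=
  castHom_mk hi hj _ _ (Equiv.refl Empty) (fun v => v.elim) (fun v => v.elim) fun _ => rfl

theorem tensor_assoc {i₁ j₁ i₂ j₂ i₃ j₃ : ℕ} (T : TermGraph S i₁ j₁) (U : TermGraph S i₂ j₂)
    (W : TermGraph S i₃ j₃) :
    castHom (Hom := fun i j => Quotient (setoid S i j)) (Nat.add_assoc i₁ i₂ i₃)
      (Nat.add_assoc j₁ j₂ j₃) (Quotient.mk _ ((T.tensor U).tensor W))
      = Quotient.mk _ (T.tensor (U.tensor W)) := by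
  have hl : ∀ n, Sum.map (Fin.cast (Nat.add_assoc i₁ i₂ i₃)) (Equiv.sumAssoc T.V U.V W.V)
      ((T.tensor U).parInl W (T.parInl U n)) = T.parInl (U.tensor W) n := by
    rintro (n | n) <;> rfl
  have hm : ∀ n, Sum.map (Fin.cast (Nat.add_assoc i₁ i₂ i₃)) (Equiv.sumAssoc T.V U.V W.V)
      ((T.tensor U).parInl W (T.parInr U n)) = T.parInr (U.tensor W) (U.parInl W n) := by
    rintro (n | n) <;> rfl
  have hr : ∀ n, Sum.map (Fin.cast (Nat.add_assoc i₁ i₂ i₃)) (Equiv.sumAssoc T.V U.V W.V)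
      ((T.tensor U).parInr W n) = T.parInr (U.tensor W) (U.parInr W n) := by
    rintro (n | n)
    · exact congrArg Sum.inl (Fin.ext (Nat.add_assoc i₁ i₂ n))
    · rfl
  refine castHom_mk _ _ ((T.tensor U).tensor W) (T.tensor (U.tensor W))
    (Equiv.sumAssoc _ _ _) ?_ ?_ fun o => ?_
  · rintro ((v | v) | v) <;> rfl
  · rintro ((v | v) | v)
    · exact map12 hl (T.ch v)
    · exact map22 hm (U.ch v)
    · exact map21 hr (W.ch v)
  · refine Fin.addCases (fun o => ?_) (fun o => ?_) o
    · refine Fin.addCases (fun o => ?_) (fun o => ?_) o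
      · rw [show Fin.cast (Nat.add_assoc j₁ j₂ j₃) (Fin.castAdd j₃ (Fin.castAdd j₂ o))
          = Fin.castAdd (j₂ + j₃) o from rfl]
        rw [tensor_out_left, tensor_out_left, tensor_out_left]
        exact (hl (T.out o)).symm
      · rw [show Fin.cast (Nat.add_assoc j₁ j₂ j₃) (Fin.castAdd j₃ (Fin.natAdd j₁ o))
          = Fin.natAdd j₁ (Fin.castAdd j₃ o) from rfl]
        rw [tensor_out_left, tensor_out_right, tensor_out_right, tensor_out_left]
        exact (hm (U.out o)).symm
    · rw [show Fin.cast (Nat.add_assoc j₁ j₂ j₃) (Fin.natAdd (j₁ + j₂) o)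
        = Fin.natAdd j₁ (Fin.natAdd j₂ o) from Fin.ext (Nat.add_assoc j₁ j₂ o)]
      rw [tensor_out_right, tensor_out_right, tensor_out_right]
      exact (hr (W.out o)).symm

theorem tensor_wiring_zero (T : TermGraph S i j) :
    castHom (Hom := fun i j => Quotient (setoid S i j)) (Nat.add_zero i) (Nat.add_zero j)
      (Quotient.mk _ (T.tensor (wiring S fun o : Fin 0 => o))) = Quotient.mk _ T := by
  have hl : ∀ n, Sum.map (Fin.cast (Nat.add_zero i)) (Equiv.sumEmpty T.V Empty)
      (T.parInl (wiring S fun o : Fin 0 => o) n) = n := by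
    rintro (n | n) <;> rfl
  refine castHom_mk _ _ (T.tensor (wiring S fun o : Fin 0 => o)) T
    (Equiv.sumEmpty T.V Empty) ?_ ?_ fun o => ?_
  · rintro (v | v)
    · rfl
    · exact v.elim
  · rintro (v | v)
    · exact map01 hl (T.ch v)
    · exact v.elim
  · refine Fin.addCases (fun o => ?_) (fun o => o.elim0) o
    rw [tensor_out_left]
    exact (hl (T.out o)).symm

theorem wiring_zero_tensor (T : TermGraph S i j) :
    castHom (Hom := fun i j => Quotient (setoid S i j)) (Nat.zero_add i) (Nat.zero_add j)
      (Quotient.mk _ ((wiring S fun o : Fin 0 => o).tensor T)) = Quotient.mk _ T := by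
  have hr : ∀ n, Sum.map (Fin.cast (Nat.zero_add i)) (Equiv.emptySum Empty T.V)
      ((wiring S fun o : Fin 0 => o).parInr T n) = n := by
    rintro (n | n)
    · exact congrArg Sum.inl (Fin.ext (Nat.zero_add n))
    · rfl
  refine castHom_mk _ _ ((wiring S fun o : Fin 0 => o).tensor T) T
    (Equiv.emptySum Empty T.V) ?_ ?_ fun o => ?_
  · rintro (v | v)
    · exact v.elim
    · rfl
  · rintro (v | v)
    · exact v.elim
    · exact map01 hr (T.ch v)
  · refine Fin.addCases (fun o => o.elim0) (fun o => ?_) o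
    rw [tensor_out_right, show Fin.cast (Nat.zero_add j) (Fin.natAdd 0 o) = o from
      Fin.ext (Nat.zero_add o)]
    exact (hr (T.out o)).symm

theorem tensor_seq_tensor {m n : ℕ} (T₁ : TermGraph S i j) (T₂ : TermGraph S k l)
    (U₁ : TermGraph S j m) (U₂ : TermGraph S l n) :
    Iso ((T₁.tensor T₂).seq (U₁.tensor U₂)) ((T₁.seq U₁).tensor (T₂.seq U₂)) := by
  let e := Equiv.sumSumSumComm T₁.V T₂.V U₁.V U₂.V
  have h₁ : ∀ n, Sum.map id e ((T₁.tensor T₂).seqInl (U₁.tensor U₂) (T₁.parInl T₂ n))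
      = (T₁.seq U₁).parInl (T₂.seq U₂) (T₁.seqInl U₁ n) := by
    rintro (n | n) <;> rfl
  have h₂ : ∀ n, Sum.map id e ((T₁.tensor T₂).seqInl (U₁.tensor U₂) (T₁.parInr T₂ n))
      = (T₁.seq U₁).parInr (T₂.seq U₂) (T₂.seqInl U₂ n) := by
    rintro (n | n) <;> rfl
  have h₃ : ∀ n, Sum.map id e ((T₁.tensor T₂).seqInr (U₁.tensor U₂) (U₁.parInl U₂ n))
      = (T₁.seq U₁).parInl (T₂.seq U₂) (T₁.seqInr U₁ n) := by
    rintro (n | n)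
    · exact (congrArg (fun n => Sum.map id e ((T₁.tensor T₂).seqInl (U₁.tensor U₂) n))
        (tensor_out_left T₁ T₂ n)).trans (h₁ (T₁.out n))
    · rfl
  have h₄ : ∀ n, Sum.map id e ((T₁.tensor T₂).seqInr (U₁.tensor U₂) (U₁.parInr U₂ n))
      = (T₁.seq U₁).parInr (T₂.seq U₂) (T₂.seqInr U₂ n) := by
    rintro (n | n)
    · exact (congrArg (fun n => Sum.map id e ((T₁.tensor T₂).seqInl (U₁.tensor U₂) n))
        (tensor_out_right T₁ T₂ n)).trans (h₂ (T₂.out n))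
    · rfl
  refine ⟨e, ?_, ?_, fun o => ?_⟩
  · rintro ((v | v) | (v | v)) <;> rfl
  · rintro ((v | v) | (v | v))
    · exact map22 h₁ (T₁.ch v)
    · exact map22 h₂ (T₂.ch v)
    · exact map22 h₃ (U₁.ch v)
    · exact map22 h₄ (U₂.ch v)
  · refine Fin.addCases (fun o => ?_) (fun o => ?_) o
    · rw [tensor_out_left]
      exact (h₃ (U₁.out o)).symm.trans (congrArg (fun n => Sum.map id e
        ((T₁.tensor T₂).seqInr (U₁.tensor U₂) n)) (tensor_out_left U₁ U₂ o).symm)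
    · rw [tensor_out_right]
      exact (h₄ (U₂.out o)).symm.trans (congrArg (fun n => Sum.map id e
        ((T₁.tensor T₂).seqInr (U₁.tensor U₂) n)) (tensor_out_right U₁ U₂ o).symm)

theorem tensor_seq_swap (T : TermGraph S i j) (U : TermGraph S k l) :
    Iso ((T.tensor U).seq (wiring S (swapIndex j l)))
      ((wiring S (swapIndex i k)).seq (U.tensor T)) := by
  let e : (T.V ⊕ U.V) ⊕ Empty ≃ Empty ⊕ (U.V ⊕ T.V) :=
    (Equiv.sumEmpty _ _).trans ((Equiv.sumComm _ _).trans (Equiv.emptySum _ _).symm)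
  have h₁ : ∀ n, Sum.map id e ((T.tensor U).seqInl (wiring S (swapIndex j l)) (T.parInl U n))
      = (wiring S (swapIndex i k)).seqInr (U.tensor T) (U.parInr T n) := by
    rintro (n | n)
    · exact congrArg Sum.inl (Fin.append_right (Fin.natAdd i) (Fin.castAdd k) n).symm
    · rfl
  have h₂ : ∀ n, Sum.map id e ((T.tensor U).seqInl (wiring S (swapIndex j l)) (T.parInr U n))
      = (wiring S (swapIndex i k)).seqInr (U.tensor T) (U.parInl T n) := by
    rintro (n | n)
    · exact congrArg Sum.inl (Fin.append_left (Fin.natAdd i) (Fin.castAdd k) n).symm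
    · rfl
  refine ⟨e, ?_, ?_, fun o => ?_⟩
  · rintro ((v | v) | v)
    · rfl
    · rfl
    · exact v.elim
  · rintro ((v | v) | v)
    · exact map22 h₁ (T.ch v)
    · exact map22 h₂ (U.ch v)
    · exact v.elim
  · have ho : ∀ o, ((T.tensor U).seq (wiring S (swapIndex j l))).out o
        = (T.tensor U).seqInl (wiring S (swapIndex j l)) ((T.tensor U).out (swapIndex j l o)) :=
      fun _ => rfl
    have ho' : ∀ o, ((wiring S (swapIndex i k)).seq (U.tensor T)).out o
        = (wiring S (swapIndex i k)).seqInr (U.tensor T) ((U.tensor T).out o) := fun _ => rfl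
    refine Fin.addCases (fun o => ?_) (fun o => ?_) o
    · rw [ho, ho', tensor_out_left, show swapIndex j l (Fin.castAdd j o) = Fin.natAdd j o from
        Fin.append_left _ _ o, tensor_out_right]
      exact (h₂ (U.out o)).symm
    · rw [ho, ho', tensor_out_right, show swapIndex j l (Fin.natAdd l o) = Fin.castAdd l o from
        Fin.append_right _ _ o, tensor_out_left]
      exact (h₁ (T.out o)).symm

/-- Sequential composition of isomorphism classes. -/
def qseq : Quotient (setoid S i j) → Quotient (setoid S j k) → Quotient (setoid S i k) :=
  Quotient.map₂ seq fun _ _ hT _ _ hU => seq_congr hT hU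

/-- Parallel composition of isomorphism classes. -/
def qtensor : Quotient (setoid S i j) → Quotient (setoid S k l) →
    Quotient (setoid S (i + k) (j + l)) :=
  Quotient.map₂ tensor fun _ _ hT _ _ hU => tensor_congr hT hU

/-- The isomorphism class of a graph that consists of wires only. -/
def qwiring (S : Signature.{u}) {i j : ℕ} (f : Fin j → Fin i) : Quotient (setoid S i j) :=
  Quotient.mk _ (wiring S f)

theorem qseq_qwiring (f : Fin j → Fin i) (g : Fin k → Fin j) :
    qseq (qwiring S f) (qwiring S g) = qwiring S fun o => f (g o) :=
  Quotient.sound (wiring_seq_wiring f g)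

theorem qtensor_qwiring (f : Fin j → Fin i) (g : Fin l → Fin k) :
    qtensor (qwiring S f) (qwiring S g) = qwiring S (parIndex f g) :=
  Quotient.sound (wiring_tensor_wiring f g)

theorem castHom_qwiring {i' j' : ℕ} (hi : i = i') (hj : j = j') (f : Fin j → Fin i) :
    castHom (Hom := fun i j => Quotient (setoid S i j)) hi hj (qwiring S f)
      = qwiring S fun o => Fin.cast hi (f (Fin.cast hj.symm o)) :=
  castHom_wiring hi hj f

theorem qwiring_congr {f g : Fin j → Fin i} (h : ∀ o, f o = g o) : qwiring S f = qwiring S g :=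
  congrArg _ (funext h)

end TermGraph

open TermGraph in
/-- The channel category of term graphs over `S`, up to isomorphism. -/
def TermGraphs (S : Signature.{u}) : ChannelCategory where
  Hom i j := Quotient (setoid S i j)
  comp := qseq
  par := qtensor
  id i := qwiring S fun o : Fin i => o
  swap i j := qwiring S (swapIndex i j)
  copy := qwiring S fun _ => 0
  del := qwiring S Fin.elim0
  comp_assoc := by
    rintro i j k l ⟨T⟩ ⟨U⟩ ⟨W⟩
    exact Quotient.sound (seq_assoc T U W)
  id_comp := by
    rintro i j ⟨T⟩
    exact Quotient.sound (wiring_seq T)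
  comp_id := by
    rintro i j ⟨T⟩
    exact Quotient.sound (seq_wiring T)
  par_assoc := by
    rintro i₁ j₁ i₂ j₂ i₃ j₃ ⟨T⟩ ⟨U⟩ ⟨W⟩
    exact tensor_assoc T U W
  par_id_zero := by
    rintro i j ⟨T⟩
    exact tensor_wiring_zero T
  id_zero_par := by
    rintro i j ⟨T⟩
    exact wiring_zero_tensor T
  id_par_id i j := by
    rw [qtensor_qwiring, parIndex_id]
  interchange := by
    rintro i j k l m n ⟨T₁⟩ ⟨T₂⟩ ⟨U₁⟩ ⟨U₂⟩
    exact Quotient.sound (tensor_seq_tensor T₁ T₂ U₁ U₂)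
  swap_natural := by
    rintro i j k l ⟨T⟩ ⟨U⟩
    exact Quotient.sound (tensor_seq_swap T U)
  swap_swap i j := by
    rw [qseq_qwiring]
    exact qwiring_congr (swapIndex_swapIndex i j)
  swap_add i j k := by
    rw [qtensor_qwiring, qtensor_qwiring, castHom_qwiring, qseq_qwiring, castHom_qwiring]
    exact qwiring_congr (swapIndex_add i j k)
  copy_assoc := by
    rw [qtensor_qwiring, qtensor_qwiring]
    have h : ∀ f : Fin 3 → Fin 2, qseq (qwiring S fun _ : Fin 2 => (0 : Fin 1)) (qwiring S f)
        = qwiring S fun _ : Fin 3 => (0 : Fin 1) := fun f => qseq_qwiring _ f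
    exact (h _).trans (h _).symm
  copy_del_left := by
    rw [qtensor_qwiring]
    exact (qseq_qwiring _ _).trans (qwiring_congr fun _ => Subsingleton.elim _ _)
  copy_del_right := by
    rw [qtensor_qwiring]
    exact (qseq_qwiring _ _).trans (qwiring_congr fun _ => Subsingleton.elim _ _)
  copy_swap := (qseq_qwiring _ _).trans (qwiring_congr fun _ => Subsingleton.elim _ _)

/-! ### Boolean-indexed stochastic matrices -/

/-- Stochastic `2^j × 2^i`-matrices over `R`, indexed by vectors of Booleans. -/
def StochMatrix (R : Type v) [CommSemiring R] (i j : ℕ) : Type v :=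
  {A : Matrix (Fin j → Bool) (Fin i → Bool) R // ∀ x, ∑ y, A y x = 1}

namespace StochMatrix

variable {R : Type v} [CommSemiring R] {i j k l : ℕ}

@[ext] theorem ext {A B : StochMatrix R i j} (h : ∀ y x, A.1 y x = B.1 y x) : A = B :=
  Subtype.ext (Matrix.ext h)

/-- The matrix of a function: the entry at `(y, x)` is `1` if `y = f x` and `0` otherwise. -/
def ofFun (R : Type v) [CommSemiring R] {i j : ℕ} (f : (Fin i → Bool) → (Fin j → Bool)) :
    StochMatrix R i j :=
  ⟨Matrix.of fun y x => if y = f x then 1 else 0, fun x => by simp⟩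

/-- The matrix product `B * A`. -/
def mul (A : StochMatrix R i j) (B : StochMatrix R j k) : StochMatrix R i k :=
  ⟨B.1 * A.1, fun x => by
    simp_rw [Matrix.mul_apply]
    rw [Finset.sum_comm]
    simp_rw [← Finset.sum_mul, B.2, one_mul, A.2]⟩

/-- The Kronecker product, with pairs of Boolean vectors concatenated. -/
def kron (A : StochMatrix R i j) (B : StochMatrix R k l) : StochMatrix R (i + k) (j + l) :=
  ⟨Matrix.reindex (Fin.appendEquiv j l) (Fin.appendEquiv i k) (A.1 ⊗ₖ B.1), fun x => by
    rw [← (Fin.appendEquiv j l).sum_comp]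
    simp [Matrix.kroneckerMap_apply, Fintype.sum_prod_type, ← Finset.mul_sum, A.2, B.2]⟩

/-- The identity matrix. -/
def one (R : Type v) [CommSemiring R] (i : ℕ) : StochMatrix R i i :=
  ⟨1, fun x => by simp [Matrix.one_apply]⟩

theorem one_eq_ofFun : one R i = ofFun R fun x => x := by
  ext y x
  simp [one, ofFun, Matrix.one_apply]

theorem kron_apply (A : StochMatrix R i j) (B : StochMatrix R k l) (y : Fin (j + l) → Bool)
    (x : Fin (i + k) → Bool) :
    (kron A B).1 y x = A.1 (fun a => y (Fin.castAdd l a)) (fun a => x (Fin.castAdd k a)) *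
      B.1 (fun a => y (Fin.natAdd j a)) (fun a => x (Fin.natAdd i a)) := rfl

theorem castHom_apply {i' j' : ℕ} (hi : i = i') (hj : j = j') (A : StochMatrix R i j)
    (y : Fin j' → Bool) (x : Fin i' → Bool) :
    (castHom (Hom := StochMatrix R) hi hj A).1 y x
      = A.1 (fun a => y (Fin.cast hj a)) (fun a => x (Fin.cast hi a)) := by
  subst hi hj
  rfl

theorem mul_ofFun_apply (f : (Fin i → Bool) → (Fin j → Bool)) (B : StochMatrix R j k)
    (y : Fin k → Bool) (x : Fin i → Bool) : (mul (ofFun R f) B).1 y x = B.1 y (f x) := by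
  simp [mul, ofFun, Matrix.mul_apply]

theorem ofFun_mul_ofFun (f : (Fin i → Bool) → (Fin j → Bool)) (g : (Fin j → Bool) → (Fin k → Bool)) :
    mul (ofFun R f) (ofFun R g) = ofFun R fun x => g (f x) := by
  ext y x
  rw [mul_ofFun_apply]
  rfl

theorem mul_ofEquiv_apply (A : StochMatrix R i j) (e : (Fin j → Bool) ≃ (Fin k → Bool))
    (y : Fin k → Bool) (x : Fin i → Bool) : (mul A (ofFun R e)).1 y x = A.1 (e.symm y) x := by
  have h : ∀ z, y = e z ↔ e.symm y = z := fun z => (Equiv.symm_apply_eq e).symm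
  simp [mul, ofFun, Matrix.mul_apply, h]

/-- The matrix that reads its `a`-th output off its `f a`-th input. -/
def wiring (R : Type v) [CommSemiring R] {i j : ℕ} (f : Fin j → Fin i) : StochMatrix R i j :=
  ofFun R fun x a => x (f a)

theorem wiring_mul_wiring (f : Fin j → Fin i) (g : Fin k → Fin j) :
    mul (wiring R f) (wiring R g) = wiring R fun o => f (g o) :=
  ofFun_mul_ofFun _ _

theorem wiring_kron_wiring (f : Fin j → Fin i) (g : Fin l → Fin k) :
    kron (wiring R f) (wiring R g) = wiring R (parIndex f g) := by
  ext y x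
  rw [kron_apply]
  simp only [wiring, ofFun, Matrix.of_apply, ite_mul, one_mul, zero_mul, ← ite_and]
  congr 1
  simp only [eq_iff_iff, funext_iff]
  constructor
  · rintro ⟨h₁, h₂⟩ a
    refine Fin.addCases (fun a => ?_) (fun a => ?_) a
    · simp [parIndex, *]
    · simp [parIndex, *]
  · intro h
    exact ⟨fun a => by simpa [parIndex] using h (Fin.castAdd l a),
      fun a => by simpa [parIndex] using h (Fin.natAdd j a)⟩

theorem castHom_wiring {i' j' : ℕ} (hi : i = i') (hj : j = j') (f : Fin j → Fin i) :
    castHom (Hom := StochMatrix R) hi hj (wiring R f)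
      = wiring R fun o => Fin.cast hi (f (Fin.cast hj.symm o)) := by
  subst hi hj
  rfl

theorem wiring_congr {f g : Fin j → Fin i} (h : ∀ o, f o = g o) : wiring R f = wiring R g :=
  congrArg _ (funext h)

theorem kron_mul_kron {m n : ℕ} (A₁ : StochMatrix R i j) (A₂ : StochMatrix R k l)
    (B₁ : StochMatrix R j m) (B₂ : StochMatrix R l n) :
    mul (kron A₁ A₂) (kron B₁ B₂) = kron (mul A₁ B₁) (mul A₂ B₂) := by
  apply Subtype.ext
  simp only [mul, kron, Matrix.reindex_apply, Matrix.mul_kronecker_mul]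
  exact (Matrix.submatrix_mul_equiv _ _ _ _ _)

theorem kron_mul_swap (A : StochMatrix R i j) (B : StochMatrix R k l) :
    mul (kron A B) (wiring R (swapIndex j l)) = mul (wiring R (swapIndex i k)) (kron B A) := by
  ext y x
  let e : (Fin (j + l) → Bool) ≃ (Fin (l + j) → Bool) :=
    ⟨fun x a => x (swapIndex j l a), fun x a => x (swapIndex l j a),
      fun x => by funext a; simp [swapIndex_swapIndex],
      fun x => by funext a; simp [swapIndex_swapIndex]⟩
  have h := mul_ofEquiv_apply (kron A B) e y x
  refine h.trans ?_
  rw [wiring, mul_ofFun_apply, kron_apply, kron_apply, mul_comm]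
  simp [e, swapIndex]

end StochMatrix

open StochMatrix in
/-- The channel category of Boolean-indexed stochastic matrices over `R`. The entry of `copy` at
`(y, x)` is `1` if both components of `y` are equal to `x`, and `0` otherwise; all entries of the
row `del` are `1`; and `swap i j` is the permutation matrix that interchanges the first `i` with the
last `j` coordinates. -/
def BoolStoch (R : Type v) [CommSemiring R] : ChannelCategory where
  Hom i j := StochMatrix R i j
  comp := mul
  par := kron
  id i := one R i
  swap i j := ofFun R fun x a => x (swapIndex i j a)
  copy := ofFun R fun x _ => x 0
  del := ofFun R fun _ => Fin.elim0
  comp_assoc A B C := Subtype.ext (Matrix.mul_assoc C.1 B.1 A.1).symm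
  id_comp A := Subtype.ext (Matrix.mul_one A.1)
  comp_id A := Subtype.ext (Matrix.one_mul A.1)
  par_assoc {i₁ j₁ i₂ j₂ i₃ j₃} A B C := by
    ext y x
    rw [castHom_apply]
    simp only [kron_apply, mul_assoc]
    have h : ∀ {m₁ m₂ m₃ : ℕ} (x : Fin (m₁ + (m₂ + m₃)) → Bool) (a : Fin m₃),
        x (Fin.cast (Nat.add_assoc m₁ m₂ m₃) (Fin.natAdd (m₁ + m₂) a))
          = x (Fin.natAdd m₁ (Fin.natAdd m₂ a)) :=
      fun x a => congrArg x (Fin.ext (Nat.add_assoc _ _ _))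
    simp only [h]
    rfl
  par_id_zero A := by
    ext y x
    rw [castHom_apply, kron_apply]
    have : ∀ y x : Fin 0 → Bool, (one R 0).1 y x = 1 := fun y x => by
      simp [one, Subsingleton.elim y x]
    rw [this, mul_one]
    rfl
  id_zero_par A := by
    ext y x
    rw [castHom_apply, kron_apply]
    have : ∀ y x : Fin 0 → Bool, (one R 0).1 y x = 1 := fun y x => by
      simp [one, Subsingleton.elim y x]
    rw [this, one_mul]
    have h : ∀ {m : ℕ} (x : Fin m → Bool) (a : Fin m),
        x (Fin.cast (Nat.zero_add m) (Fin.natAdd 0 a)) = x a :=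
      fun x a => congrArg x (Fin.ext (Nat.zero_add _))
    simp only [h]
  id_par_id i j := by
    simp only [one_eq_ofFun]
    refine (wiring_kron_wiring (R := R) (fun a : Fin i => a) (fun a : Fin j => a)).trans ?_
    rw [parIndex_id]
    rfl
  interchange := kron_mul_kron
  swap_natural := kron_mul_swap
  swap_swap i j := by
    rw [one_eq_ofFun]
    exact (wiring_mul_wiring _ _).trans (wiring_congr (swapIndex_swapIndex i j))
  swap_add i j k := by
    simp only [one_eq_ofFun]
    change castHom (Hom := StochMatrix R) _ _ (mul (kron (wiring R _) (wiring R fun a => a))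
      (castHom (Hom := StochMatrix R) _ _ (kron (wiring R fun a => a) (wiring R _)))) = wiring R _
    rw [wiring_kron_wiring, wiring_kron_wiring, castHom_wiring, wiring_mul_wiring, castHom_wiring]
    exact wiring_congr (swapIndex_add i j k)
  copy_assoc := by
    simp only [one_eq_ofFun]
    have h : ∀ f : Fin 3 → Fin 2, mul (wiring R fun _ : Fin 2 => (0 : Fin 1)) (wiring R f)
        = wiring R fun _ : Fin 3 => (0 : Fin 1) := fun f => wiring_mul_wiring _ f
    have h₁ := wiring_kron_wiring (R := R) (fun _ : Fin 2 => (0 : Fin 1)) (fun a : Fin 1 => a)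
    have h₂ := wiring_kron_wiring (R := R) (fun a : Fin 1 => a) (fun _ : Fin 2 => (0 : Fin 1))
    exact ((congrArg (mul (wiring R fun _ : Fin 2 => (0 : Fin 1))) h₁).trans (h _)).trans
      ((congrArg (mul (wiring R fun _ : Fin 2 => (0 : Fin 1))) h₂).trans (h _)).symm
  copy_del_left := by
    have h : ofFun R (fun _ : Fin 1 → Bool => Fin.elim0) = wiring R Fin.elim0 :=
      congrArg _ (funext fun _ => Subsingleton.elim _ _)
    simp only [one_eq_ofFun, h]
    change mul (wiring R _) (kron (wiring R _) (wiring R fun a => a)) = wiring R _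
    rw [wiring_kron_wiring]
    exact (wiring_mul_wiring _ _).trans (wiring_congr fun _ => Subsingleton.elim _ _)
  copy_del_right := by
    have h : ofFun R (fun _ : Fin 1 → Bool => Fin.elim0) = wiring R Fin.elim0 :=
      congrArg _ (funext fun _ => Subsingleton.elim _ _)
    simp only [one_eq_ofFun, h]
    change mul (wiring R _) (kron (wiring R fun a => a) (wiring R _)) = wiring R _
    rw [wiring_kron_wiring]
    exact (wiring_mul_wiring _ _).trans (wiring_congr fun _ => Subsingleton.elim _ _)
  copy_swap := (wiring_mul_wiring _ _).trans (wiring_congr fun _ => Subsingleton.elim _ _)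

/-! ### Interpretations and semantics -/

/-- An interpretation of a signature in a channel category. -/
def Interpretation (S : Signature.{u}) (C : ChannelCategory.{w}) : Type (max u w) :=
  ∀ f : S.Symbol, C.Hom (S.arity f) 1

/-- The functor `F` extends the interpretation `I` of the function symbols to all term graphs. -/
def Interpretation.IsExtension {S : Signature.{u}} {C : ChannelCategory.{w}}
    (I : Interpretation S C) (F : ChannelFunctor (TermGraphs S) C) : Prop :=
  ∀ f : S.Symbol, F.map (Quotient.mk _ (TermGraph.ofSymbol f)) = I f

/-- The semantics of the term graph `T` under the interpretation `I`: the value at `T` of the unique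
functor of channel categories that extends `I`. -/
noncomputable def Interpretation.sem {S : Signature.{u}} {C : ChannelCategory.{w}}
    (I : Interpretation S C) (h : ∃! F, I.IsExtension F) {i j : ℕ} (T : TermGraph S i j) :
    C.Hom i j :=
  (Classical.choose h).map (Quotient.mk _ T)

/-! ### Attack trees -/

/-- The function symbols of attack trees with basic attack step labels `B`. -/
inductive ATSymbol (B : Type u) : Type u
  | and (n : ℕ+)
  | or (n : ℕ+)
  | basic (b : B)

/-- The signature of attack trees over `B`. -/
def AT (B : Type u) : Signature.{u} where
  Symbol := ATSymbol B
  arity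
    | .and n => n
    | .or n => n
    | .basic _ => 0

/-- An attack tree component over `B` with `i` inputs and `j` outputs. -/
abbrev ATComponent (B : Type u) (i j : ℕ) := TermGraph (AT B) i j

/-- The stochastic matrix interpretation. The gates are interpreted by the matrices of the Boolean
functions `⋀` and `⋁`, and a label `b` by the column with the entries `α₀ b` and `α₁ b` at the
Booleans `0` and `1`. -/
def stochInterpretation {B : Type u} {R : Type v} [CommSemiring R] (α₀ α₁ : B → R)
    (hα : ∀ b, α₀ b + α₁ b = 1) : Interpretation (AT B) (BoolStoch R)
  | .and n => StochMatrix.ofFun R (i := n) fun x _ => decide (∀ m, x m = true)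
  | .or n => StochMatrix.ofFun R (i := n) fun x _ => decide (∃ m, x m = true)
  | .basic b =>
    ⟨Matrix.of fun y _ => if y 0 = true then α₁ b else α₀ b, fun x => by
      rw [← (Equiv.funUnique (Fin 1) Bool).symm.sum_comp]
      simp [Equiv.funUnique, uniqueElim, add_comm, hα]⟩

/-- The symbol is a basic attack step label. -/
def ATSymbol.IsBasic {B : Type u} : ATSymbol B → Prop
  | .basic _ => True
  | _ => False

/-- The basic attack step label that the symbol is. -/
def ATSymbol.toLabel {B : Type u} : (s : ATSymbol B) → s.IsBasic → B
  | .basic b, _ => b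

/-- The value of a node labelled `s` with the list `c` of values of its children: conjunction or
disjunction of `c` for a gate, and `p` for a basic attack step. -/
def ATSymbol.eval {B : Type u} : (s : ATSymbol B) → (p : s.IsBasic → Bool) → (c : List Bool) → Bool
  | .and _, _, c => c.all fun t => t
  | .or _, _, c => c.any fun t => t
  | .basic _, p, _ => p trivial

namespace ATComponent

variable {B : Type u} {i j : ℕ}

/-- The basic attack steps: the nodes with a label in `B`. -/
abbrev BAS (T : ATComponent B i j) : Type :=
  {v : T.V // ATSymbol.IsBasic (T.label v)}

noncomputable instance (T : ATComponent B i j) : Fintype T.BAS :=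
  Fintype.ofFinite _

/-- The label of a basic attack step. -/
def basLabel (T : ATComponent B i j) (v : T.BAS) : B :=
  ATSymbol.toLabel (T.label v.1) v.2

/-- An attack tells for each basic attack step whether it is performed. -/
abbrev Attack (T : ATComponent B i j) : Type :=
  T.BAS → Bool

noncomputable instance (T : ATComponent B i j) : Fintype T.Attack :=
  Fintype.ofFinite _

/-- The Boolean value `S_T(a, x; n)` of the node `n` under the attack `a` and the inputs `x`,
by recursion along the acyclic graph. -/
noncomputable def nodeValue (T : ATComponent B i j) (a : T.Attack) (x : Fin i → Bool) :
    T.Node → Bool :=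
  T.wf.fix fun n value =>
    match n, value with
    | Sum.inl k, _ => x k
    | Sum.inr v, value => ATSymbol.eval (T.label v) (fun h => a ⟨v, h⟩)
        ((T.ch v).attach.map fun m => value m.1 ⟨v, rfl, m.2⟩)

theorem nodeValue_inl (T : ATComponent B i j) (a : T.Attack) (x : Fin i → Bool) (k : Fin i) :
    T.nodeValue a x (Sum.inl k) = x k := by
  rw [nodeValue, WellFounded.fix_eq]

/-- The recursion that defines the structure function, at non-input nodes. -/
theorem nodeValue_inr (T : ATComponent B i j) (a : T.Attack) (x : Fin i → Bool) (v : T.V) :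
    T.nodeValue a x (Sum.inr v) = ATSymbol.eval (T.label v) (fun h => a ⟨v, h⟩)
      ((T.ch v).map (T.nodeValue a x)) := by
  exact (WellFounded.fix_eq _ _ _).trans (congrArg (ATSymbol.eval (T.label v) fun h => a ⟨v, h⟩)
    (List.attach_map_val (l := T.ch v) (f := T.nodeValue a x)))

/-- The structure function `S_T(a, x)`. -/
noncomputable def structureFunction (T : ATComponent B i j) (a : T.Attack) (x : Fin i → Bool) :
    Fin j → Bool :=
  fun o => T.nodeValue a x (T.out o)

end ATComponent

end AttackTree

open AttackTree

/-!
Existence. For a graph `T : i → j`, let the entry at `(y, x)` be the sum of the weights of the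
attacks `a` with `S_T(a, x) = y`. Summing over all `y` gives the sum of the weights of all attacks,
a product of factors `α₀ b + α₁ b = 1`, so these entries form a stochastic matrix. This assignment
is a functor. The basic attack steps of a sequential or parallel composite are those of its two
parts, hence an attack on the composite is a pair of attacks and its weight is the product of their
weights (`sum_attack_eq`, `weight_eq_mul`), while the structure function of the composite is the
composite or the juxtaposition of the structure functions of the parts (`structureFunction_seq`,
`structureFunction_tensor_castAdd`, `structureFunction_tensor_natAdd`, all instances of
`nodeValue_map`). In a sequential composite the outcome of the first part is the intermediate index
of the matrix product (`entry_seq`).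

Uniqueness. Two functors that agree on the graphs of the function symbols agree everywhere, whatever
their target (`ChannelFunctor.eq_of_map_ofSymbol`). They agree on graphs without internal nodes, as
all maps between finite sets of wires are generated by identities, interchanges, `copy` and `del`
(`wiring_induction`). A graph with internal nodes has one, `v`, whose children are all inputs. The
graph then factors into one that duplicates some of its inputs and feeds them to the label of `v`,
and one in which `v` has become an additional input (`iso_oneNode_seq_split`); the latter has fewer
internal nodes.

The formula for the semantics holds because the functor given by the entries is the unique one.
-/


namespace AttackTree

/-! ### Wirings are generated by identities, swaps, copy and del -/

theorem val_append_self (i : ℕ) (a : Fin (i + i)) :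
    ((Fin.append (fun a : Fin i => a) (fun a => a) a : Fin i) : ℕ) =
      if (a : ℕ) < i then (a : ℕ) else a - i := by
  refine Fin.addCases (fun a => ?_) (fun a => ?_) a
  · simp
  · rw [Fin.append_right]
    simp

/-- Duplication of `i + 1` wires: duplicate the first `i` wires and the last wire, then move the
first copy of the last wire in front of the second copies of the others. -/
theorem append_self_succ (i : ℕ) (o : Fin (i + 1 + (i + 1))) :
    Fin.append (fun a : Fin (i + 1) => a) (fun a => a) o =
      parIndex (Fin.append (fun a : Fin i => a) (fun a => a)) (fun _ : Fin 2 => (0 : Fin 1))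
        (Fin.cast (by omega) (parIndex (parIndex (fun a : Fin i => a) (swapIndex i 1))
          (fun a : Fin 1 => a) (Fin.cast (by omega) o))) := by
  ext
  simp only [val_append_self, val_parIndex, val_swapIndex, Fin.val_cast, Fin.val_eq_zero]
  split_ifs <;> omega

theorem append_self_parIndex {i j l : ℕ} (f : Fin j → Fin i) (g : Fin l → Fin i) (o : Fin (j + l)) :
    Fin.append (fun a : Fin i => a) (fun a => a) (parIndex f g o) = Fin.append f g o := by
  refine Fin.addCases (fun a => ?_) (fun a => ?_) o
  · rw [parIndex, Fin.append_left, Fin.append_left, Fin.append_left]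
  · rw [parIndex, Fin.append_right, Fin.append_right, Fin.append_right]

/-- Every map between finite sets of wires arises from identities, interchanges, the duplication and
the deletion of a single wire by composition and juxtaposition. -/
theorem wiring_induction {P : ∀ {i j : ℕ}, (Fin j → Fin i) → Prop}
    (id : ∀ i, P (fun o : Fin i => o)) (swap : ∀ i j, P (swapIndex i j))
    (copy : P (fun _ : Fin 2 => (0 : Fin 1))) (del : P (Fin.elim0 : Fin 0 → Fin 1))
    (comp : ∀ {i j k : ℕ} (f : Fin j → Fin i) (g : Fin k → Fin j), P f → P g → P fun o => f (g o))
    (par : ∀ {i j k l : ℕ} (f : Fin j → Fin i) (g : Fin l → Fin k), P f → P g → P (parIndex f g))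
    {i j : ℕ} (f : Fin j → Fin i) : P f := by
  have cast : ∀ {i j i' j' : ℕ} (hi : i = i') (hj : j' = j) (f : Fin j → Fin i), P f →
      P fun o => Fin.cast hi (f (Fin.cast hj o)) := by
    rintro i j _ _ rfl rfl f hf
    exact hf
  have delAll : ∀ (i : ℕ) (f : Fin 0 → Fin i), P f := by
    intro i
    induction i with
    | zero => exact fun f => Subsingleton.elim (fun o => o) f ▸ id 0
    | succ i ih =>
      intro f
      exact Subsingleton.elim (α := Fin 0 → Fin (i + 1)) (parIndex (Fin.elim0 : Fin 0 → Fin i)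
        (Fin.elim0 : Fin 0 → Fin 1)) f ▸ par _ _ (ih _) del
  have dup : ∀ i : ℕ, P (Fin.append (fun a : Fin i => a) (fun a => a)) := by
    intro i
    induction i with
    | zero => exact delAll 0 _
    | succ i ih =>
      rw [funext (append_self_succ i)]
      exact comp _ _ (par _ _ ih copy) (cast (by omega) (by omega) _
        (par _ _ (par _ _ (id i) (swap i 1)) (id 1)))
  have select : ∀ {i : ℕ} (k : Fin i), P fun _ : Fin 1 => k := by
    intro i k
    have h := cast (by omega : (k : ℕ) + (1 + (i - k - 1)) = i) (by omega : 1 = 0 + (1 + 0)) _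
      (par _ _ (delAll k Fin.elim0) (par _ _ (id 1) (delAll (i - k - 1) Fin.elim0)))
    convert h using 1
    funext o
    ext
    simp [val_parIndex]
  induction j with
  | zero => exact delAll i f
  | succ j ih =>
    have h := comp _ _ (dup i) (par _ _ (ih fun o => f o.castSucc) (select (f (Fin.last j))))
    convert h using 1
    funext o
    rw [append_self_parIndex]
    refine Fin.addCases (fun a => ?_) (fun a => ?_) o
    · rw [Fin.append_left]
      rfl
    · rw [Fin.append_right, Subsingleton.elim a 0]
      rfl

namespace TermGraph

variable {S : Signature.{u}} {i j : ℕ}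

/-! ### Splitting off a node whose children are inputs -/

open Classical in
/-- The node map that turns the node `v` into a new last input. -/
noncomputable def splitNode (T : TermGraph S i j) (v : T.V) :
    T.Node → Fin (i + 1) ⊕ {w : T.V // w ≠ v} :=
  Sum.elim (fun k => Sum.inl k.castSucc)
    (fun w => if h : w = v then Sum.inl (Fin.last i) else Sum.inr ⟨w, h⟩)

/-- The inverse of `splitNode`. -/
def unsplitNode (T : TermGraph S i j) (v : T.V) : Fin (i + 1) ⊕ {w : T.V // w ≠ v} → T.Node :=
  Sum.elim (Fin.snoc Sum.inl (Sum.inr v)) (fun w => Sum.inr w.1)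

theorem unsplitNode_splitNode (T : TermGraph S i j) (v : T.V) (n : T.Node) :
    T.unsplitNode v (T.splitNode v n) = n := by
  rcases n with n | n
  · simp [unsplitNode, splitNode]
  · by_cases h : n = v <;> simp [unsplitNode, splitNode, h]

/-- The term graph in which the node `v` is replaced by a new last input. -/
noncomputable def split (T : TermGraph S i j) (v : T.V) : TermGraph S (i + 1) j where
  V := {w : T.V // w ≠ v}
  finite := inferInstance
  label w := T.label w
  ch w := (T.ch w).map (T.splitNode v)
  out o := T.splitNode v (T.out o)
  length_ch w := by simpa using T.length_ch w
  acyclic n hn := by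
    refine T.acyclic _ (hn.lift (T.unsplitNode v) ?_)
    rintro _ m ⟨w, rfl, hm⟩
    obtain ⟨m, hm, rfl⟩ := List.mem_map.1 hm
    exact ⟨w, rfl, by rwa [unsplitNode_splitNode]⟩

/-- The graph that passes on its inputs, followed by a node labelled `f` whose children are the
inputs listed by `g`. -/
def oneNode {S : Signature.{u}} {i : ℕ} (f : S.Symbol) (g : Fin (S.arity f) → Fin i) :
    TermGraph S i (i + 1) :=
  (wiring S (Fin.append (fun k => k) g)).seq ((wiring S fun k : Fin i => k).tensor (ofSymbol f))

theorem map_ofFn_of_comp {α β γ δ ε : Type} {n : ℕ} {f : Fin n → α} {a : α → β} {b : β → γ}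
    {c : γ → δ} {d : δ → ε} {g : Fin n → ε} (h : ∀ k, g k = d (c (b (a (f k))))) :
    List.ofFn g = ((((List.ofFn f).map a).map b).map c).map d := by
  simp only [List.map_ofFn]
  exact congrArg List.ofFn (funext h)

theorem iso_oneNode_seq_split (T : TermGraph S i j) (v : T.V)
    (g : Fin (S.arity (T.label v)) → Fin i) (hg : T.ch v = List.ofFn fun k => Sum.inl (g k)) :
    Iso ((oneNode (T.label v) g).seq (T.split v)) T := by
  classical
  let N := oneNode (T.label v) g
  let e : (Empty ⊕ (Empty ⊕ Unit)) ⊕ {w : T.V // w ≠ v} ≃ T.V :=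
    { toFun := Sum.elim (fun _ => v) Subtype.val
      invFun := fun w => if h : w = v then Sum.inl (Sum.inr (Sum.inr ())) else Sum.inr ⟨w, h⟩
      left_inv := by
        rintro ((n | n | n) | w)
        · exact n.elim
        · exact n.elim
        · simp
        · simp [w.2]
      right_inv := fun w => by by_cases h : w = v <;> simp [h] }
  let φ : Fin (i + 1) ⊕ {w : T.V // w ≠ v} → T.Node := fun n =>
    Sum.map id e (N.seqInr (T.split v) n)
  have hs : ∀ n, φ n = T.unsplitNode v n := by
    rintro (n | n)
    · refine Fin.lastCases ?_ (fun k => ?_) n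
      · refine (congrArg (fun m => Sum.map id e (N.seqInl (T.split v)
          (seqInr _ _ m))) (tensor_out_right _ _ 0)).trans ?_
        exact (Fin.snoc_last (α := fun _ => T.Node) _ _).symm
      · refine (congrArg (fun m => Sum.map id e (N.seqInl (T.split v)
          (seqInr _ _ m))) (tensor_out_left _ _ k)).trans ?_
        exact (congrArg Sum.inl (Fin.append_left (fun k => k) g k)).trans
          (Fin.snoc_castSucc (α := fun _ => T.Node) _ _ _).symm
    · rfl
  have hr : ∀ n, φ (T.splitNode v n) = n := fun n => by
    rw [hs, unsplitNode_splitNode]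
  refine ⟨e, ?_, ?_, fun o => (hr (T.out o)).symm⟩
  · rintro ((n | n | n) | w)
    · exact n.elim
    · exact n.elim
    · rfl
    · rfl
  · rintro ((n | n | n) | w)
    · exact n.elim
    · exact n.elim
    · exact hg.trans (map_ofFn_of_comp (f := Sum.inl) fun k =>
        congrArg Sum.inl (Fin.append_right (fun k => k) g k).symm)
    · exact (map01 hr (T.ch w.1)).trans (List.map_map (f := N.seqInr (T.split v))
        (g := Sum.map id e)).symm

/-- In an acyclic graph with internal nodes, some internal node has only inputs as children. -/
theorem exists_ch_eq_inputs (T : TermGraph S i j) [Nonempty T.V] :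
    ∃ (v : T.V) (g : Fin (S.arity (T.label v)) → Fin i),
      T.ch v = List.ofFn fun k => Sum.inl (g k) := by
  obtain ⟨v, -, hv⟩ := (InvImage.wf (Sum.inr : T.V → T.Node) T.wf).has_min Set.univ
    Set.univ_nonempty
  have h : ∀ k : Fin (T.ch v).length, ∃ m : Fin i, (T.ch v).get k = Sum.inl m := by
    intro k
    rcases hk : (T.ch v).get k with m | w
    · exact ⟨m, rfl⟩
    · exact absurd ⟨v, rfl, hk ▸ List.get_mem _ k⟩ (hv w trivial)
  choose g hg using h
  refine ⟨v, fun k => g (Fin.cast (T.length_ch v).symm k), ?_⟩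
  apply List.ext_get
  · simp [T.length_ch]
  · intro n h₁ h₂
    rw [hg ⟨n, h₁⟩]
    simp

theorem iso_wiring_of_isEmpty (T : TermGraph S i j) [IsEmpty T.V] :
    ∃ f : Fin j → Fin i, Iso (wiring S f) T := by
  have h : ∀ o, ∃ k, T.out o = Sum.inl k := fun o => by
    rcases T.out o with k | v
    · exact ⟨k, rfl⟩
    · exact isEmptyElim v
  choose f hf using h
  exact ⟨f, (Equiv.equivOfIsEmpty Empty T.V), fun v => v.elim, fun v => v.elim, hf⟩

end TermGraph

open TermGraph in
/-- A functor on term graphs is determined by its values on the function symbols. -/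
theorem ChannelFunctor.eq_of_map_ofSymbol {S : Signature.{u}} {C : ChannelCategory.{w}}
    (F G : ChannelFunctor (TermGraphs S) C)
    (h : ∀ f : S.Symbol, F.map (Quotient.mk _ (ofSymbol f)) = G.map (Quotient.mk _ (ofSymbol f))) :
    F = G := by
  have hcomp : ∀ {i j k : ℕ} (T : (TermGraphs S).Hom i j) (U : (TermGraphs S).Hom j k),
      F.map T = G.map T → F.map U = G.map U →
        F.map (qseq T U) = G.map (qseq T U) := fun T U hT hU =>
    (F.map_comp T U).trans (hT ▸ hU ▸ (G.map_comp T U).symm)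
  have hpar : ∀ {i j k l : ℕ} (T : (TermGraphs S).Hom i j) (U : (TermGraphs S).Hom k l),
      F.map T = G.map T → F.map U = G.map U →
        F.map (qtensor T U) = G.map (qtensor T U) := fun T U hT hU =>
    (F.map_par T U).trans (hT ▸ hU ▸ (G.map_par T U).symm)
  have hwiring : ∀ {i j : ℕ} (f : Fin j → Fin i),
      F.map (C := TermGraphs S) (qwiring S f) = G.map (C := TermGraphs S) (qwiring S f) := by
    intro i j f
    induction f using wiring_induction with
    | id i => exact (F.map_id i).trans (G.map_id i).symm
    | swap i j => exact (F.map_swap i j).trans (G.map_swap i j).symm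
    | copy => exact F.map_copy.trans G.map_copy.symm
    | del => exact F.map_del.trans G.map_del.symm
    | comp f g hf hg => exact qseq_qwiring (S := S) f g ▸ hcomp _ _ hf hg
    | par f g hf hg => exact qtensor_qwiring (S := S) f g ▸ hpar _ _ hf hg
  have key : ∀ (n : ℕ) {i j : ℕ} (T : TermGraph S i j), Nat.card T.V = n →
      F.map (C := TermGraphs S) (Quotient.mk _ T) =
        G.map (C := TermGraphs S) (Quotient.mk _ T) := by
    intro n
    induction n using Nat.strong_induction_on with
    | _ n ih =>
      intro i j T hn
      rcases isEmpty_or_nonempty T.V with hV | hV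
      · obtain ⟨f, hf⟩ := T.iso_wiring_of_isEmpty
        rw [← Quotient.sound hf]
        exact hwiring f
      -- the graph that remains after splitting off `v` has fewer internal nodes
      · obtain ⟨v, g, hg⟩ := T.exists_ch_eq_inputs
        rw [← Quotient.sound (T.iso_oneNode_seq_split v g hg)]
        refine hcomp (Quotient.mk _ _) (Quotient.mk _ _)
          (hcomp (Quotient.mk _ _) (Quotient.mk _ _) (hwiring _)
            (hpar (Quotient.mk _ _) (Quotient.mk _ _) (hwiring _) (h _))) ?_
        exact ih _ (hn ▸ Finite.card_subtype_lt (x := v) (by simp)) (T.split v) rfl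
  apply ChannelFunctor.ext
  funext i j T
  induction T using Quotient.inductionOn with
  | _ T => exact key _ T rfl

/-! ### Structure functions of composites -/

theorem ATSymbol.eval_congr {B : Type u} {s s' : ATSymbol B} (h : s' = s) (p : s.IsBasic → Bool)
    (c : List Bool) : s.eval p c = s'.eval (fun hs => p (h ▸ hs)) c := by
  subst h
  rfl

namespace ATComponent

open TermGraph

variable {B : Type u} {i j k l : ℕ}

/-- The attack induced by a label-preserving map of internal nodes. -/
def Attack.comap {T : ATComponent B i j} {U : ATComponent B k l} (a : U.Attack) (e : T.V → U.V)
    (he : ∀ v, U.label (e v) = T.label v) : T.Attack :=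
  fun v => a ⟨e v.1, (he v.1).symm ▸ v.2⟩

/-- Node values are preserved by maps of nodes that preserve labels and lists of children, if the
inputs of the source receive the values of their images. -/
theorem nodeValue_map {T : ATComponent B i j} {U : ATComponent B k l} (e : T.V → U.V)
    (φ : T.Node → U.Node) (he : ∀ v, U.label (e v) = T.label v)
    (hφ : ∀ v, φ (Sum.inr v) = Sum.inr (e v)) (hch : ∀ v, U.ch (e v) = (T.ch v).map φ)
    (a : U.Attack) (x : Fin k → Bool) (x' : Fin i → Bool)
    (hx : ∀ m, U.nodeValue a x (φ (Sum.inl m)) = x' m) (n : T.Node) :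
    U.nodeValue a x (φ n) = T.nodeValue (a.comap e he) x' n := by
  induction n using T.wf.induction with
  | _ n ih =>
    rcases n with m | v
    · rw [hx, nodeValue_inl]
    · rw [hφ, nodeValue_inr, nodeValue_inr, hch, List.map_map,
        ATSymbol.eval_congr (he v).symm]
      congr 1
      exact List.map_congr_left fun m hm => ih m ⟨v, rfl, hm⟩

/-- The weight of an attack: each basic attack step contributes `α₁` or `α₀` of its label,
according to whether it is performed. -/
noncomputable def weight {R : Type v} [CommSemiring R] (α₀ α₁ : B → R) (T : ATComponent B i j)
    (a : T.Attack) : R :=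
  ∏ v : T.BAS, if a v = true then α₁ (T.basLabel v) else α₀ (T.basLabel v)

/-- The sum of the weights of the attacks that lead from the inputs `x` to the outputs `y`. -/
noncomputable def entry {R : Type v} [CommSemiring R] (α₀ α₁ : B → R) (T : ATComponent B i j)
    (y : Fin j → Bool) (x : Fin i → Bool) : R :=
  ∑ a : T.Attack, if T.structureFunction a x = y then T.weight α₀ α₁ a else 0

theorem toLabel_congr {s s' : ATSymbol B} (h : s = s') (hs : s.IsBasic) (hs' : s'.IsBasic) :
    s.toLabel hs = s'.toLabel hs' := by
  subst h
  rfl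

/-- The entries of the matrix of a graph are invariant under isomorphism. -/
theorem entry_congr {R : Type v} [CommSemiring R] (α₀ α₁ : B → R) {T U : ATComponent B i j}
    (h : Iso T U) : T.entry α₀ α₁ = U.entry α₀ α₁ := by
  obtain ⟨e, hl, hch, ho⟩ := h
  let E : T.BAS ≃ U.BAS := e.subtypeEquiv fun v => by rw [hl]
  funext y x
  refine (Fintype.sum_equiv (E.symm.arrowCongr (Equiv.refl Bool)) _ _ fun a => ?_).symm
  have hS : U.structureFunction a x = T.structureFunction (Attack.comap a e hl) x := by
    funext o
    rw [structureFunction, ho]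
    exact nodeValue_map e (Sum.map id e) hl (fun _ => rfl) hch a x x
      (fun m => nodeValue_inl U a x m) _
  have hw : U.weight α₀ α₁ a = T.weight α₀ α₁ (Attack.comap a e hl) := by
    refine (Fintype.prod_equiv E _ _ fun v => ?_).symm
    have hb : T.basLabel v = U.basLabel (E v) := toLabel_congr (hl v.1).symm _ _
    rw [hb]
    rfl
  rw [hS, hw]
  rfl

section Sum

variable {i' j' : ℕ} {R : Type v} [CommSemiring R] (α₀ α₁ : B → R)
  {T : ATComponent B i j} {U : ATComponent B k l} {W : ATComponent B i' j'}

/-- If the internal nodes of `W` are those of `T` and of `U`, then so are the basic attack steps. -/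
def basEquiv (e : T.V ⊕ U.V ≃ W.V) (hT : ∀ v, W.label (e (Sum.inl v)) = T.label v)
    (hU : ∀ v, W.label (e (Sum.inr v)) = U.label v) :
    T.BAS ⊕ U.BAS ≃ W.BAS :=
  Equiv.trans (Equiv.subtypeSum (p := fun v => ATSymbol.IsBasic (Sum.elim T.label U.label v))).symm
    (e.subtypeEquiv (by
      rintro (v | v)
      · exact iff_of_eq (congrArg ATSymbol.IsBasic (hT v).symm)
      · exact iff_of_eq (congrArg ATSymbol.IsBasic (hU v).symm)))

/-- An attack on `W` is a pair of an attack on `T` and an attack on `U`. -/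
theorem sum_attack_eq (e : T.V ⊕ U.V ≃ W.V) (hT : ∀ v, W.label (e (Sum.inl v)) = T.label v)
    (hU : ∀ v, W.label (e (Sum.inr v)) = U.label v)
    (g : T.Attack → U.Attack → R) :
    ∑ a : W.Attack, g (Attack.comap a (fun v => e (Sum.inl v)) hT)
        (Attack.comap a (fun v => e (Sum.inr v)) hU) =
      ∑ b : T.Attack, ∑ c : U.Attack, g b c := by
  rw [← Fintype.sum_prod_type']
  exact Fintype.sum_equiv (((basEquiv e hT hU).symm.arrowCongr (Equiv.refl Bool)).trans
    (Equiv.sumArrowEquivProdArrow _ _ _)) _ _ fun a => rfl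

/-- The weight of an attack is the product of the weights of its restrictions to the two parts. -/
theorem weight_eq_mul (e : T.V ⊕ U.V ≃ W.V) (hT : ∀ v, W.label (e (Sum.inl v)) = T.label v)
    (hU : ∀ v, W.label (e (Sum.inr v)) = U.label v)
    (a : W.Attack) :
    W.weight α₀ α₁ a = T.weight α₀ α₁ (Attack.comap a (fun v => e (Sum.inl v)) hT) *
      U.weight α₀ α₁ (Attack.comap a (fun v => e (Sum.inr v)) hU) := by
  rw [weight, ← (basEquiv e hT hU).prod_comp, Fintype.prod_sum_type]
  congr 1
  · refine Finset.prod_congr rfl fun v _ => ?_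
    have hb : T.basLabel v = W.basLabel (basEquiv e hT hU (Sum.inl v)) :=
      toLabel_congr (hT v.1).symm _ _
    rw [hb]
    rfl
  · refine Finset.prod_congr rfl fun v _ => ?_
    have hb : U.basLabel v = W.basLabel (basEquiv e hT hU (Sum.inr v)) :=
      toLabel_congr (hU v.1).symm _ _
    rw [hb]
    rfl

end Sum

/-! ### The matrix of an attack tree component -/

section Matrix

variable {R : Type v} [CommSemiring R] (α₀ α₁ : B → R)

theorem nodeValue_seqInl (T : ATComponent B i j) (U : ATComponent B j k)
    (a : Attack (T.seq U)) (x : Fin i → Bool) (n : T.Node) :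
    nodeValue (T.seq U) a x (T.seqInl U n) =
      T.nodeValue (Attack.comap a Sum.inl fun _ => rfl) x n :=
  nodeValue_map (U := T.seq U) Sum.inl (T.seqInl U) (fun _ => rfl) (fun _ => rfl)
    (fun _ => rfl) a x x (fun m => nodeValue_inl (T.seq U) a x m) n

theorem structureFunction_seq (T : ATComponent B i j) (U : ATComponent B j k)
    (a : Attack (T.seq U)) (x : Fin i → Bool) :
    structureFunction (T.seq U) a x = U.structureFunction (Attack.comap a Sum.inr fun _ => rfl)
      (T.structureFunction (Attack.comap a Sum.inl fun _ => rfl) x) := by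
  funext o
  exact nodeValue_map (U := T.seq U) Sum.inr (T.seqInr U) (fun _ => rfl) (fun _ => rfl)
    (fun _ => rfl) a x _ (fun m => nodeValue_seqInl T U a x (T.out m)) (U.out o)

theorem structureFunction_tensor_castAdd (T : ATComponent B i j) (U : ATComponent B k l)
    (a : Attack (T.tensor U)) (x : Fin (i + k) → Bool) (o : Fin j) :
    structureFunction (T.tensor U) a x (Fin.castAdd l o) =
      T.structureFunction (Attack.comap a Sum.inl fun _ => rfl)
        (fun m => x (Fin.castAdd k m)) o := by
  rw [structureFunction, tensor_out_left]
  exact nodeValue_map (U := T.tensor U) Sum.inl (T.parInl U) (fun _ => rfl) (fun _ => rfl)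
    (fun _ => rfl) a x _ (fun m => nodeValue_inl (T.tensor U) a x (Fin.castAdd k m)) (T.out o)

theorem structureFunction_tensor_natAdd (T : ATComponent B i j) (U : ATComponent B k l)
    (a : Attack (T.tensor U)) (x : Fin (i + k) → Bool) (o : Fin l) :
    structureFunction (T.tensor U) a x (Fin.natAdd j o) =
      U.structureFunction (Attack.comap a Sum.inr fun _ => rfl)
        (fun m => x (Fin.natAdd i m)) o := by
  rw [structureFunction, tensor_out_right]
  exact nodeValue_map (U := T.tensor U) Sum.inr (T.parInr U) (fun _ => rfl) (fun _ => rfl)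
    (fun _ => rfl) a x _ (fun m => nodeValue_inl (T.tensor U) a x (Fin.natAdd i m)) (U.out o)

/-- Sequential composites give matrix products, the intermediate index being the outcome of the
first graph. -/
theorem entry_seq (T : ATComponent B i j) (U : ATComponent B j k) (y : Fin k → Bool)
    (x : Fin i → Bool) :
    entry α₀ α₁ (T.seq U) y x = ∑ z, U.entry α₀ α₁ y z * T.entry α₀ α₁ z x := by
  have h : ∀ a : Attack (T.seq U),
      (if structureFunction (T.seq U) a x = y then weight α₀ α₁ (T.seq U) a else 0) = _ :=
    fun a => by
    rw [structureFunction_seq, weight_eq_mul α₀ α₁ (T := T) (U := U) (W := T.seq U) (Equiv.refl _)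
      (fun _ => rfl) (fun _ => rfl) a]
  rw [entry, Finset.sum_congr rfl fun a _ => h a]
  refine (sum_attack_eq (T := T) (U := U) (W := T.seq U) (Equiv.refl _) (fun _ => rfl)
    (fun _ => rfl) fun b c => if U.structureFunction c (T.structureFunction b x) = y then
      T.weight α₀ α₁ b * U.weight α₀ α₁ c else 0).trans ?_
  simp only [entry, Finset.sum_mul_sum]
  refine Finset.sum_comm.trans (Eq.trans ?_ Finset.sum_comm)
  refine Finset.sum_congr rfl fun c _ => Eq.trans ?_ Finset.sum_comm
  refine Finset.sum_congr rfl fun b _ => ?_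
  rw [Finset.sum_eq_single (T.structureFunction b x)]
  · simp [mul_comm]
  · intro z _ hz
    rw [if_neg hz.symm, mul_zero]
  · simp

theorem entry_tensor (T : ATComponent B i j) (U : ATComponent B k l) (y : Fin (j + l) → Bool)
    (x : Fin (i + k) → Bool) :
    entry α₀ α₁ (T.tensor U) y x =
      T.entry α₀ α₁ (fun a => y (Fin.castAdd l a)) (fun a => x (Fin.castAdd k a)) *
        U.entry α₀ α₁ (fun a => y (Fin.natAdd j a)) (fun a => x (Fin.natAdd i a)) := by
  have hS : ∀ a : Attack (T.tensor U), structureFunction (T.tensor U) a x = y ↔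
      T.structureFunction (Attack.comap a Sum.inl fun _ => rfl) (fun m => x (Fin.castAdd k m)) =
        (fun o => y (Fin.castAdd l o)) ∧
      U.structureFunction (Attack.comap a Sum.inr fun _ => rfl) (fun m => x (Fin.natAdd i m)) =
        fun o => y (Fin.natAdd j o) := by
    intro a
    simp only [funext_iff, Fin.forall_fin_add, structureFunction_tensor_castAdd,
      structureFunction_tensor_natAdd]
  have h : ∀ a : Attack (T.tensor U),
      (if structureFunction (T.tensor U) a x = y then weight α₀ α₁ (T.tensor U) a else 0) = _ :=
    fun a => by
      rw [if_congr (hS a) rfl rfl, weight_eq_mul α₀ α₁ (T := T) (U := U) (W := T.tensor U)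
        (Equiv.refl _) (fun _ => rfl) (fun _ => rfl) a]
  rw [entry, Finset.sum_congr rfl fun a _ => h a]
  refine (sum_attack_eq (T := T) (U := U) (W := T.tensor U) (Equiv.refl _) (fun _ => rfl)
    (fun _ => rfl) fun b c =>
      if T.structureFunction b (fun m => x (Fin.castAdd k m)) = (fun o => y (Fin.castAdd l o)) ∧
        U.structureFunction c (fun m => x (Fin.natAdd i m)) = (fun o => y (Fin.natAdd j o)) then
      T.weight α₀ α₁ b * U.weight α₀ α₁ c else 0).trans ?_
  simp only [entry, Finset.sum_mul_sum, ite_zero_mul_ite_zero]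

theorem weight_of_isEmpty (T : ATComponent B i j) [IsEmpty T.BAS] (a : T.Attack) :
    T.weight α₀ α₁ a = 1 :=
  Fintype.prod_empty _

/-- Without basic attack steps, the matrix is that of the structure function. -/
theorem entry_of_isEmpty (T : ATComponent B i j) [IsEmpty T.BAS] (a : T.Attack)
    (f : (Fin i → Bool) → Fin j → Bool) (hf : ∀ x, T.structureFunction a x = f x)
    (y : Fin j → Bool) (x : Fin i → Bool) :
    T.entry α₀ α₁ y x = (StochMatrix.ofFun R f).1 y x := by
  rw [entry, Fintype.sum_subsingleton _ a, weight_of_isEmpty, hf]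
  simp only [StochMatrix.ofFun, Matrix.of_apply, eq_comm]

/-- The matrix of entries is stochastic: the sum over all attacks of their weights is the expanded
product of the sums `α₀ b + α₁ b` over the basic attack steps. -/
theorem sum_entry (hα : ∀ b, α₀ b + α₁ b = 1) (T : ATComponent B i j) (x : Fin i → Bool) :
    ∑ y, T.entry α₀ α₁ y x = 1 := by
  classical
  simp only [entry]
  rw [Finset.sum_comm]
  simp only [Finset.sum_ite_eq, Finset.mem_univ, if_true, weight]
  have h := Finset.prod_univ_sum (fun _ : T.BAS => (Finset.univ : Finset Bool))
    (fun v t => if t = true then α₁ (T.basLabel v) else α₀ (T.basLabel v))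
  simp only [Fintype.sum_bool, if_true, Bool.false_eq_true, if_false, Fintype.piFinset_univ,
    fun b => (add_comm (α₁ b) (α₀ b)).trans (hα b), Finset.prod_const_one] at h
  rw [h]
  exact Finset.sum_congr (by ext; simp) fun _ _ => rfl

/-- The entry written as a sum over the attacks that lead from `x` to `y`. -/
theorem entry_eq_sum_filter (T : ATComponent B i j) (y : Fin j → Bool) (x : Fin i → Bool) :
    T.entry α₀ α₁ y x = ∑ a : T.Attack with T.structureFunction a x = y,
      (∏ v : T.BAS with a v = true, α₁ (T.basLabel v)) *
        (∏ v : T.BAS with a v = false, α₀ (T.basLabel v)) := by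
  rw [entry, Finset.sum_filter]
  simp only [weight, Finset.prod_ite, Bool.not_eq_true]

end Matrix

end ATComponent

/-! ### The functor -/

open TermGraph ATComponent

variable {B : Type u} {R : Type v} [CommSemiring R]

/-- The stochastic matrix with the entries `T.entry α₀ α₁ y x`. -/
noncomputable def attackMatrix (α₀ α₁ : B → R) (hα : ∀ b, α₀ b + α₁ b = 1) {i j : ℕ}
    (T : ATComponent B i j) : StochMatrix R i j :=
  ⟨Matrix.of (T.entry α₀ α₁), sum_entry α₀ α₁ hα T⟩

theorem attackMatrix_wiring (α₀ α₁ : B → R) (hα : ∀ b, α₀ b + α₁ b = 1) {i j : ℕ}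
    (f : Fin j → Fin i) :
    attackMatrix α₀ α₁ hα (wiring (AT B) f) = StochMatrix.wiring R f := by
  have : IsEmpty (BAS (wiring (AT B) f)) := ⟨fun v => Empty.elim v.1⟩
  exact StochMatrix.ext fun y x => entry_of_isEmpty α₀ α₁ (wiring (AT B) f) isEmptyElim _
    (fun x => funext fun o => nodeValue_inl _ _ x (f o)) y x

theorem structureFunction_ofSymbol (f : ATSymbol B) (a : Attack (ofSymbol (S := AT B) f))
    (x : Fin ((AT B).arity f) → Bool) (o : Fin 1) :
    structureFunction (ofSymbol (S := AT B) f) a x o =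
      f.eval (fun h => a ⟨(), h⟩) (List.ofFn x) := by
  refine (nodeValue_inr (ofSymbol (S := AT B) f) a x ()).trans ?_
  congr 1
  refine List.map_ofFn.trans (congrArg List.ofFn (funext fun k => ?_))
  exact nodeValue_inl _ _ _ _

/-- The functor from term graphs to stochastic matrices that sends a graph to its matrix of sums of
weights of attacks. -/
noncomputable def attackFunctor (α₀ α₁ : B → R) (hα : ∀ b, α₀ b + α₁ b = 1) :
    ChannelFunctor (TermGraphs (AT B)) (BoolStoch R) where
  map {i j} := Quotient.lift
    (fun T : ATComponent B i j => attackMatrix α₀ α₁ hα T)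
    fun _ _ h => Subtype.ext (congrArg Matrix.of (entry_congr α₀ α₁ h))
  map_comp := by
    rintro i j k ⟨T⟩ ⟨U⟩
    exact StochMatrix.ext fun y x => entry_seq α₀ α₁ T U y x
  map_par := by
    rintro i j k l ⟨T⟩ ⟨U⟩
    exact StochMatrix.ext fun y x => entry_tensor α₀ α₁ T U y x
  map_id i := (attackMatrix_wiring α₀ α₁ hα _).trans StochMatrix.one_eq_ofFun.symm
  map_swap i j := attackMatrix_wiring α₀ α₁ hα _
  map_copy := attackMatrix_wiring α₀ α₁ hα _
  map_del := (attackMatrix_wiring α₀ α₁ hα _).trans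
    (congrArg (StochMatrix.ofFun R) (funext fun _ => Subsingleton.elim _ _))

theorem attackFunctor_isExtension (α₀ α₁ : B → R) (hα : ∀ b, α₀ b + α₁ b = 1) :
    (stochInterpretation α₀ α₁ hα).IsExtension (attackFunctor α₀ α₁ hα) := by
  rintro (n | n | b)
  · have : IsEmpty (BAS (ofSymbol (S := AT B) (.and n))) := ⟨fun v => v.2⟩
    refine StochMatrix.ext fun y x => entry_of_isEmpty α₀ α₁ (ofSymbol (S := AT B) (.and n))
      isEmptyElim _ (fun x => funext fun o => ?_) y x
    rw [structureFunction_ofSymbol, Bool.eq_iff_iff]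
    simp [ATSymbol.eval]
    rfl
  · have : IsEmpty (BAS (ofSymbol (S := AT B) (.or n))) := ⟨fun v => v.2⟩
    refine StochMatrix.ext fun y x => entry_of_isEmpty α₀ α₁ (ofSymbol (S := AT B) (.or n))
      isEmptyElim _ (fun x => funext fun o => ?_) y x
    rw [structureFunction_ofSymbol, Bool.eq_iff_iff]
    simp [ATSymbol.eval]
    rfl
  · refine StochMatrix.ext fun y x => ?_
    let T : ATComponent B 0 1 := ofSymbol (S := AT B) (.basic b)
    let v : T.BAS := ⟨(), trivial⟩
    have : Subsingleton T.BAS := ⟨fun _ _ => Subtype.ext (Subsingleton.elim (α := Unit) _ _)⟩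
    have hS : ∀ a : T.Attack, T.structureFunction a x = fun _ => a v := fun a =>
      funext fun o => structureFunction_ofSymbol (.basic b) a x o
    -- the only attack with the outcome `y` gives the value `y 0` to the only basic attack step
    change T.entry α₀ α₁ y x = if y 0 = true then α₁ b else α₀ b
    refine (Fintype.sum_eq_single (fun _ => y 0) fun a ha => ?_).trans ?_
    · refine if_neg fun h => ha (funext fun w => ?_)
      rw [← h, hS, Subsingleton.elim w v]
    · rw [if_pos, weight, Fintype.prod_subsingleton _ v]
      · rfl
      · rw [hS]
        exact funext fun o => congrArg y (Subsingleton.elim _ _)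

end AttackTree

theorem mainTheorem1 {B : Type u} {R : Type v} [CommSemiring R] (α₀ α₁ : B → R)
    (hα : ∀ b, α₀ b + α₁ b = 1) :
    ∃ h : ∃! F : ChannelFunctor (TermGraphs (AT B)) (BoolStoch R),
        (stochInterpretation α₀ α₁ hα).IsExtension F,
      ∀ (i j : ℕ) (T : ATComponent B i j) (y : Fin j → Bool) (x : Fin i → Bool),
        ((stochInterpretation α₀ α₁ hα).sem h T : StochMatrix R i j).1 y x =
          ∑ a : T.Attack with T.structureFunction a x = y,
            (∏ v : T.BAS with a v = true, α₁ (T.basLabel v)) *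
              (∏ v : T.BAS with a v = false, α₀ (T.basLabel v)) := by
  have hF := attackFunctor_isExtension α₀ α₁ hα
  have h : ∃! F, (stochInterpretation α₀ α₁ hα).IsExtension F :=
    ⟨attackFunctor α₀ α₁ hα, hF, fun G hG =>
      ChannelFunctor.eq_of_map_ofSymbol _ _ fun f => (hG f).trans (hF f).symm⟩
  refine ⟨h, fun i j T y x => ?_⟩
  rw [← ATComponent.entry_eq_sum_filter]
  exact congrArg (fun F : ChannelFunctor (TermGraphs (AT B)) (BoolStoch R) =>
    (F.map (Quotient.mk _ T) : StochMatrix R i j).1 y x) ((Classical.choose_spec h).2 _ hF).symm
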